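/- Let $q\in\mathbb C$ with $0<|q|<1$. For $x\in\mathbb C$ put $(x;q)_\infty=\prod_{n\ge 0}(1-xq^n)$, and for $n\in\mathbb Z$ let $(x;q)_n=(x;q)_\infty/(q^nx;q)_\infty$, i.e. $(x;q)_n=\prod_{k=0}^{n-1}(1-xq^k)$ and $(x;q)_{-n}=\prod_{k=1}^{n}(1-xq^{-k})^{-1}$ for $n\ge 0$; write $(x_1,\dots,x_m;q)_n=(x_1;q)_n\cdots(x_m;q)_n$, also for $n=\infty$. For $x\ne 0$ put $$\theta(x)=\frac1{(q;q)_\infty}\sum_{n=-\infty}^{\infty}(-1)^nq^{n(n-1)/2}x^n,\qquad \theta(x_1,\dots,x_m)=\theta(x_1)\cdots\theta(x_m),$$ $$\Omega(x_1,\dots,x_n;a_1,\dots,a_m)=\prod_{i=1}^n\prod_{j=1}^m(x_i/a_j;q)_\infty .$$ The very-well-poised bilateral series is $${}_8\psi_8[a;a_3,\dots,a_8;q,w]=\sum_{n=-\infty}^{\infty}\frac{(a_1,a_2,a_3,\dots,a_8;q)_n}{(aq/a_1,aq/a_2,aq/a_3,\dots,aq/a_8;q)_n}\,w^n,\qquad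 a_1=q\sqrt a,\ a_2=-q\sqrt a .$$ Let $a,b,c,d,e,z$ be nonzero complex numbers with $a=de$, $bc=zq$ and $|aq/z|<1$. Assume that no denominator below vanishes, namely: $a\ne q^{2k}$ for all $k\in\mathbb Z$; for each $x\in\{b,c,d,e,a/z,z\}$ and each integer $k\ge 0$, $x\ne q^{k+1}$ and $aq^{k+1}\ne x$; and $dq^k\ne z$, $eq^k\ne z$ for all integers $k\ge 0$. Then the series ${}_8\psi_8[a;b,c,d,e,a/z,z;q,aq/z]$ converges absolutely, and $${}_8\psi_8[a;b,c,d,e,a/z,z;q,aq/z]=\frac{(q,q,aq,q/a,aq/(dz),aq/(ez);q)_\infty\,\Delta}{(q/z,zq/a;q)_\infty\,\Omega(1/z;1/b,1/c,1/d,1/e)\,\Omega(aq;b,c,d,e)},$$ where $$\Delta=\frac{\theta(d,e)\,(b,c,aq/(bz),aq/(cz);q)_\infty-\theta(z,a/z)\,(aq/(bd),aq/(be),aq/(cd),aq/(ce);q)_\infty}{z\,(q/d,q/e,zq,aq/z;q)_\infty}.$$ -/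

import Mathlib

noncomputable section

namespace QSeries

/-- The infinite `q`-shifted factorial `(x; q)_∞ = ∏_{n ≥ 0} (1 - x q ^ n)`. -/
def qInf (q x : ℂ) : ℂ := ∏' n : ℕ, (1 - x * q ^ n)

/-- The multi-parameter infinite factorial `(x₁, …, x_m; q)_∞`. -/
def qInfs (q : ℂ) (xs : List ℂ) : ℂ := (xs.map (qInf q)).prod

/-- The `q`-shifted factorial `(x; q)_n` for an integer `n`:
`(x; q)_n = (1 - x) (1 - x q) ⋯ (1 - x q ^ (n - 1))` and
`(x; q)_{-n} = 1 / ((1 - x / q) (1 - x / q ^ 2) ⋯ (1 - x / q ^ n))` for `n ≥ 0`.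
It is `(x; q)_∞ / (q ^ n x; q)_∞` whenever the denominator does not vanish,
see `qPoch_eq_div`. -/
def qPoch (q x : ℂ) : ℤ → ℂ
  | Int.ofNat n => ∏ k ∈ Finset.range n, (1 - x * q ^ k)
  | Int.negSucc n => (∏ k ∈ Finset.range (n + 1), (1 - x / q ^ (k + 1)))⁻¹

/-- The multi-parameter factorial `(x₁, …, x_m; q)_n` for an integer `n`. -/
def qPochs (q : ℂ) (xs : List ℂ) (n : ℤ) : ℂ := (xs.map fun x => qPoch q x n).prod

/-- The Jacobi theta function
`θ(x) = (q; q)_∞⁻¹ ∑_{n ∈ ℤ} (-1) ^ n q ^ (n (n - 1) / 2) x ^ n`. -/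
def theta (q x : ℂ) : ℂ :=
  (∑' n : ℤ, (-1) ^ n * q ^ (n * (n - 1) / 2) * x ^ n) / qInf q q

/-- The multi-parameter theta function `θ(x₁, …, x_m) = θ(x₁) ⋯ θ(x_m)`. -/
def thetas (q : ℂ) (xs : List ℂ) : ℂ := (xs.map (theta q)).prod

/-- `Ω(x₁, …, x_n; a₁, …, a_m) = ∏_i ∏_j (x_i / a_j; q)_∞`. -/
def Omega (q : ℂ) (xs as : List ℂ) : ℂ :=
  (xs.map fun x => (as.map fun a => qInf q (x / a)).prod).prod

/-- The `n`-th term of the bilateral series `ᵣψᵣ[as; bs; q, z]`. -/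
def psiTerm (q : ℂ) (as bs : List ℂ) (z : ℂ) (n : ℤ) : ℂ :=
  qPochs q as n / qPochs q bs n * z ^ n

/-- The upper parameters `q √a, -q √a, a₃, …, aᵣ` of a very-well-poised series. -/
def vwpUpper (q a : ℂ) (as : List ℂ) : List ℂ :=
  q * a ^ (1 / 2 : ℂ) :: -(q * a ^ (1 / 2 : ℂ)) :: as

/-- The `n`-th term of the very-well-poised series `ᵣψᵣ[a; a₃, …, aᵣ; q, z]`: the lower
parameter under the upper parameter `x` is `a q / x`. -/
def vwpPsiTerm (q a : ℂ) (as : List ℂ) (z : ℂ) (n : ℤ) : ℂ :=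
  psiTerm q (vwpUpper q a as) ((vwpUpper q a as).map fun x => a * q / x) z n

/-- The very-well-poised bilateral series `ᵣψᵣ[a; a₃, …, aᵣ; q, z]`. -/
def vwpPsi (q a : ℂ) (as : List ℂ) (z : ℂ) : ℂ := ∑' n : ℤ, vwpPsiTerm q a as z n

theorem qInf_eq_mul {q : ℂ} (hq : ‖q‖ < 1) (x : ℂ) :
    qInf q x = (1 - x) * qInf q (x * q) := by
  have hm : ∀ y : ℂ, Multipliable fun n : ℕ => (1 - y * q ^ n) := by
    intro y
    have h : Summable fun n : ℕ => ‖-(y * q ^ n)‖ := by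
      simp only [norm_neg, norm_mul, norm_pow]
      exact (summable_geometric_of_lt_one (norm_nonneg q) hq).mul_left _
    simpa [sub_eq_add_neg] using multipliable_one_add_of_summable h
  have hs : (fun n : ℕ => 1 - x * q ^ (n + 1)) = fun n : ℕ => 1 - x * q * q ^ n := by
    funext n; ring
  unfold qInf
  rw [tprod_eq_zero_mul' (f := fun n : ℕ => 1 - x * q ^ n) (by rw [hs]; exact hm (x * q)), hs]
  simp

theorem qPoch_eq_div {q : ℂ} (hq0 : q ≠ 0) (hq : ‖q‖ < 1) (x : ℂ) (n : ℤ)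
    (h : qInf q (q ^ n * x) ≠ 0) : qPoch q x n = qInf q x / qInf q (q ^ n * x) := by
  have hnat : ∀ (n : ℕ) (y : ℂ),
      qInf q y = (∏ k ∈ Finset.range n, (1 - y * q ^ k)) * qInf q (y * q ^ n) := by
    intro n y
    induction n with
    | zero => simp
    | succ n ih =>
      rw [ih, Finset.prod_range_succ, qInf_eq_mul hq (y * q ^ n), pow_succ]
      ring_nf
  cases n with
  | ofNat n =>
    rw [eq_div_iff h, hnat n x]
    simp [qPoch, mul_comm]
  | negSucc n =>
    have e : q ^ (Int.negSucc n) * x * q ^ (n + 1) = x := by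
      rw [zpow_negSucc]; field_simp
    have h2 := hnat (n + 1) (q ^ (Int.negSucc n) * x)
    rw [e] at h2
    have e2 : (∏ k ∈ Finset.range (n + 1), (1 - q ^ (Int.negSucc n) * x * q ^ k))
        = ∏ k ∈ Finset.range (n + 1), (1 - x / q ^ (k + 1)) := by
      rw [← Finset.prod_range_reflect]
      refine Finset.prod_congr rfl fun k hk => ?_
      have hk' : k ≤ n := Nat.lt_succ_iff.mp (Finset.mem_range.mp hk)
      have e3 : q ^ (n + 1) = q ^ (n - k) * q ^ (k + 1) := by
        rw [← pow_add]; congr 1; omega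
      rw [zpow_negSucc, e3, show n + 1 - 1 - k = n - k by omega]
      field_simp
    rw [e2] at h2
    simp only [qPoch]
    rw [h2]
    have h3 : qInf q x ≠ 0 := fun h0 => h (by rw [h2, h0, mul_zero])
    rw [inv_eq_one_div, ← div_div, eq_comm, div_right_comm, div_self h3]

end QSeries

end

noncomputable section

namespace QSeries

open Filter Topology Finset

/-! ### Infinite shifted factorials -/

/-! Put X = q^n, y = a/z, B = 1/b, C = 1/c. Since a = de = yz, the lower parameter under d is eq,
and so on, so the four parameters d, e, y, z contribute only a constant over
(1-dX)(1-eX)(1-yX)(1-zX). Replacing B by t = qB produces a factor (X-t)(1-atX), and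
(y+z-d-e)(X-t)(1-atX) = (1-yt)(1-zt)(1-dX)(1-eX) - (1-dt)(1-et)(1-yX)(1-zX). Partial fractions
therefore split the ₈ψ₈ series into two ₆ψ₆ series, one for the pair (y, z) and one for (d, e)
(`doublePairTerm_eq`); these give the two products in Δ.

Each ₆ψ₆ is summed by `tsum_pairTerm_eq`. A telescoping sum (`hasSum_wp_zero`) relates its values at
B and qB; iterating in B and in C reduces everything to B = C = 0 (`tsum_pairTerm_reduce`). The
constant left over is found from B = 1, C = 1/a, where only the term n = 0 survives; when a is a
nonzero power of q it is 0 by antisymmetry (`tsum_pairTerm_zero`). Finally the triple product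
`theta_eq` turns the theta functions into infinite products, and a rational identity remains. -/

theorem summable_norm_mul_pow {q : ℂ} (hq : ‖q‖ < 1) (x : ℂ) :
    Summable fun n : ℕ => ‖-(x * q ^ n)‖ := by
  simp only [norm_neg, norm_mul, norm_pow]
  exact (summable_geometric_of_lt_one (norm_nonneg q) hq).mul_left _

theorem tendsto_prod_qInf {q : ℂ} (hq : ‖q‖ < 1) (x : ℂ) :
    Tendsto (fun N : ℕ => ∏ k ∈ range N, (1 - x * q ^ k)) atTop (𝓝 (qInf q x)) := by
  have h : Multipliable fun n : ℕ => (1 - x * q ^ n) := by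
    simpa [sub_eq_add_neg] using multipliable_one_add_of_summable (summable_norm_mul_pow hq x)
  exact h.hasProd.tendsto_prod_nat

theorem qInf_ne_zero {q : ℂ} (hq : ‖q‖ < 1) {x : ℂ} (hx : ∀ k : ℕ, x * q ^ k ≠ 1) :
    qInf q x ≠ 0 := by
  have h := tprod_one_add_ne_zero_of_summable (f := fun n : ℕ => -(x * q ^ n))
    (fun i => by
      rw [← sub_eq_add_neg]
      exact sub_ne_zero.2 (hx i).symm) (summable_norm_mul_pow hq x)
  simpa [qInf, sub_eq_add_neg] using h

theorem qInf_eq_zero {q : ℂ} (hq : ‖q‖ < 1) {x : ℂ} {k : ℕ} (hx : x * q ^ k = 1) :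
    qInf q x = 0 := by
  refine tendsto_nhds_unique (tendsto_prod_qInf hq x) (tendsto_const_nhds.congr' ?_)
  filter_upwards [eventually_gt_atTop k] with N hN
  exact (prod_eq_zero (mem_range.2 hN) (by rw [hx, sub_self])).symm

theorem pow_succ_ne_one {q : ℂ} (hq : ‖q‖ < 1) (k : ℕ) : q ^ (k + 1) ≠ 1 := by
  intro h
  have h2 := congrArg norm h
  rw [norm_pow, norm_one] at h2
  exact (pow_lt_one₀ (norm_nonneg q) hq k.succ_ne_zero).ne h2

theorem qInf_self_ne_zero {q : ℂ} (hq : ‖q‖ < 1) : qInf q q ≠ 0 :=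
  qInf_ne_zero hq fun k => by
    rw [← pow_succ']
    exact pow_succ_ne_one hq k

/-! ### The Jacobi triple product -/

/-- The finite factorial `(q; q)_m`. -/
def qFact (q : ℂ) (m : ℕ) : ℂ := ∏ k ∈ range m, (1 - q * q ^ k)

/-- The reciprocal `1 / (q; q)_m`, extended by `0` to negative `m`. -/
def qFactInv (q : ℂ) : ℤ → ℂ
  | Int.ofNat m => (qFact q m)⁻¹
  | Int.negSucc _ => 0

/-- The coefficient `(-1) ^ n q ^ (n (n - 1) / 2)` of the theta series. -/
def thetaCoeff (q : ℂ) (n : ℤ) : ℂ := (-1) ^ n * q ^ (n * (n - 1) / 2)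

theorem qFact_succ (q : ℂ) (m : ℕ) : qFact q (m + 1) = qFact q m * (1 - q ^ (m + 1)) := by
  rw [qFact, prod_range_succ, ← pow_succ', qFact]

theorem qFact_ne_zero {q : ℂ} (hq : ‖q‖ < 1) (m : ℕ) : qFact q m ≠ 0 :=
  prod_ne_zero_iff.2 fun k _ => sub_ne_zero.2 (by
    rw [← pow_succ']
    exact (pow_succ_ne_one hq k).symm)

/-- The recursion crosses m = -1 because 1 - q^0 = 0; this is why the extension by 0 is the right
one. -/
theorem qFactInv_eq {q : ℂ} (hq : ‖q‖ < 1) (m : ℤ) :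
    qFactInv q m = (1 - q ^ (m + 1)) * qFactInv q (m + 1) := by
  cases m with
  | ofNat m =>
    have h := sub_ne_zero.2 (pow_succ_ne_one hq m).symm
    have h2 := qFact_ne_zero hq m
    change (qFact q m)⁻¹ = (1 - q ^ ((m + 1 : ℕ) : ℤ)) * (qFact q (m + 1))⁻¹
    rw [qFact_succ, zpow_natCast]
    field_simp
  | negSucc m =>
    cases m with
    | zero => simp [qFactInv]
    | succ m =>
      have : Int.negSucc (m + 1) + 1 = Int.negSucc m := by omega
      rw [this]
      simp [qFactInv]

theorem thetaCoeff_succ {q : ℂ} (hq0 : q ≠ 0) (n : ℤ) :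
    thetaCoeff q (n + 1) = -thetaCoeff q n * q ^ n := by
  have h : (n + 1) * (n + 1 - 1) / 2 = n * (n - 1) / 2 + n := by
    rw [show (n + 1) * (n + 1 - 1) = n * (n - 1) + n * 2 by ring,
      Int.add_mul_ediv_right _ _ two_ne_zero]
  rw [thetaCoeff, thetaCoeff, h, zpow_add₀ hq0, zpow_add_one₀ (by norm_num)]
  ring

/-- The finite q-binomial theorem in symmetric form: the coefficients are the Gaussian binomials of
2N over N + n, and letting N → ∞ gives the triple product. -/
theorem hasSum_finite_triple_product {q x : ℂ} (hq0 : q ≠ 0) (hq : ‖q‖ < 1) (hx : x ≠ 0)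
    (N : ℕ) :
    HasSum (fun n : ℤ => qFact q (2 * N) * qFactInv q (N - n) * qFactInv q (N + n) *
        (thetaCoeff q n * x ^ n))
      ((∏ k ∈ range N, (1 - x * q ^ k)) * ∏ k ∈ range N, (1 - q / x * q ^ k)) := by
  induction N with
  | zero =>
    convert hasSum_single (0 : ℤ) _ using 1
    · simp [qFact, qFactInv, thetaCoeff]
    · intro n hn
      obtain ⟨m, rfl | rfl⟩ := n.eq_nat_or_neg
      · obtain ⟨m, rfl⟩ := Nat.exists_eq_succ_of_ne_zero (n := m) (by simpa using hn)
        have : ((0 : ℕ) : ℤ) - (m.succ : ℕ) = Int.negSucc m := by omega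
        rw [this]
        simp [qFactInv]
      · obtain ⟨m, rfl⟩ := Nat.exists_eq_succ_of_ne_zero (n := m) (by simpa using hn)
        have : ((0 : ℕ) : ℤ) + -((m.succ : ℕ) : ℤ) = Int.negSucc m := by omega
        rw [this]
        simp [qFactInv]
  | succ N ih =>
    have h1 := (Equiv.subRight (1 : ℤ)).hasSum_iff.2 ih
    have h2 := (Equiv.addRight (1 : ℤ)).hasSum_iff.2 ih
    -- The new factors expand as (1 - xq^N)(1 - q^(N+1)/x) = 1 + q^(2N+1) - xq^N - q^(N+1)/x; the
    -- last two terms shift the summation index.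
    convert ((ih.mul_left (1 + q * (q ^ N) ^ 2)).sub (h1.mul_left (x * q ^ N))).sub
      (h2.mul_left (q / x * q ^ N)) using 1
    · rfl
    · funext n
      simp only [Function.comp_apply, Equiv.coe_addRight, Equiv.subRight_apply]
      have e1 : thetaCoeff q n = -thetaCoeff q (n - 1) * q ^ (n - 1) := by
        simpa using thetaCoeff_succ hq0 (n - 1)
      have e1' : thetaCoeff q (n - 1) = -thetaCoeff q n * q / q ^ n := by
        rw [e1, zpow_sub_one₀ hq0]
        have := zpow_ne_zero n hq0
        field_simp
      rw [e1', thetaCoeff_succ hq0]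
      have a1 := qFactInv_eq hq ((N : ℤ) - n)
      have a2 := qFactInv_eq hq ((N : ℤ) + n)
      have a3 := qFactInv_eq hq ((N : ℤ) - (n + 1))
      have a4 := qFactInv_eq hq ((N : ℤ) + (n - 1))
      rw [show (N : ℤ) - (n + 1) + 1 = N - n by ring] at a3
      rw [show (N : ℤ) + (n - 1) + 1 = N + n by ring] at a4
      rw [show (N : ℤ) - (n - 1) = N - n + 1 by ring, show (N : ℤ) + (n + 1) = N + n + 1 by ring,
        a3, a4, a1, a2, show ((N + 1 : ℕ) : ℤ) - n = N - n + 1 by push_cast; ring,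
        show ((N + 1 : ℕ) : ℤ) + n = N + n + 1 by push_cast; ring,
        show 2 * (N + 1) = 2 * N + 1 + 1 by ring, qFact_succ, qFact_succ]
      generalize qFactInv q ((N : ℤ) - n + 1) = R
      generalize qFactInv q ((N : ℤ) + n + 1) = S
      simp only [zpow_add₀ hq0, zpow_sub₀ hq0, zpow_add₀ hx, zpow_sub₀ hx, zpow_natCast, zpow_one,
        pow_succ, pow_mul, mul_comm 2 N]
      have := zpow_ne_zero n hq0
      have := zpow_ne_zero n hx
      field_simp
      ring
    · rw [prod_range_succ, prod_range_succ]
      field_simp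
      ring

theorem summable_of_ratio_tendsto {u r : ℕ → ℂ} {ρ : ℂ} (h : ∀ n, u (n + 1) = u n * r n)
    (hr : Tendsto r atTop (𝓝 ρ)) (hρ : ‖ρ‖ < 1) : Summable fun n => ‖u n‖ := by
  obtain ⟨s, hs1, hs2⟩ := exists_between hρ
  refine summable_of_ratio_norm_eventually_le hs2 ?_
  filter_upwards [hr.norm.eventually_lt_const hs1] with n hn
  rw [norm_norm, norm_norm, h, norm_mul, mul_comm]
  exact mul_le_mul_of_nonneg_right hn.le (norm_nonneg _)

theorem tendsto_pow_zero {q : ℂ} (hq : ‖q‖ < 1) : Tendsto (fun n : ℕ => q ^ n) atTop (𝓝 0) :=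
  tendsto_pow_atTop_nhds_zero_of_norm_lt_one hq

theorem summable_thetaCoeff {q x : ℂ} (hq0 : q ≠ 0) (hq : ‖q‖ < 1) (hx : x ≠ 0) :
    Summable fun n : ℤ => ‖thetaCoeff q n * x ^ n‖ := by
  refine Summable.of_nat_of_neg ?_ ?_
  · refine summable_of_ratio_tendsto (u := fun n : ℕ => thetaCoeff q n * x ^ (n : ℤ))
      (r := fun n : ℕ => -(q ^ n * x)) (ρ := 0) (fun n => ?_) ?_ (by simp)
    · push_cast
      rw [thetaCoeff_succ hq0, zpow_add_one₀ hx, zpow_natCast q]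
      ring
    · simpa using ((tendsto_pow_zero hq).mul_const x).neg
  · refine summable_of_ratio_tendsto (u := fun n : ℕ => thetaCoeff q (-n) * x ^ (-n : ℤ))
      (r := fun n : ℕ => -(q ^ n * q * x⁻¹)) (ρ := 0) (fun n => ?_) ?_ (by simp)
    · have h := thetaCoeff_succ hq0 (-(n : ℤ) - 1)
      rw [sub_add_cancel, zpow_sub_one₀ hq0, zpow_neg, zpow_natCast] at h
      push_cast
      rw [show -((n : ℤ) + 1) = -n - 1 by ring, h, zpow_sub_one₀ hx]
      have := pow_ne_zero n hq0
      field_simp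
    · simpa using (((tendsto_pow_zero hq).mul_const q).mul_const x⁻¹).neg

theorem tendsto_qFact {q : ℂ} (hq : ‖q‖ < 1) : Tendsto (qFact q) atTop (𝓝 (qInf q q)) :=
  tendsto_prod_qInf hq q

theorem tendsto_qFactInv {q : ℂ} (hq : ‖q‖ < 1) :
    Tendsto (qFactInv q) atTop (𝓝 (qInf q q)⁻¹) := by
  have h := ((tendsto_qFact hq).inv₀ (qInf_self_ne_zero hq)).comp
    (tendsto_atTop.2 fun b => by
      filter_upwards [eventually_ge_atTop (b : ℤ)] with n hn
      exact (Int.le_toNat (by omega)).2 hn : Tendsto Int.toNat atTop atTop)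
  refine h.congr' ?_
  filter_upwards [eventually_ge_atTop 0] with n hn
  lift n to ℕ using hn
  rfl

theorem exists_norm_le_of_tendsto {u : ℕ → ℂ} {l : ℂ} (h : Tendsto u atTop (𝓝 l)) :
    ∃ C, 0 ≤ C ∧ ∀ n, ‖u n‖ ≤ C := by
  obtain ⟨C, hC⟩ := h.norm.bddAbove_range
  exact ⟨C, (norm_nonneg _).trans (hC ⟨0, rfl⟩), fun n => hC ⟨n, rfl⟩⟩

/-- The Jacobi triple product identity. -/
theorem theta_eq {q x : ℂ} (hq0 : q ≠ 0) (hq : ‖q‖ < 1) (hx : x ≠ 0) :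
    theta q x = qInf q x * qInf q (q / x) := by
  have h0 := qInf_self_ne_zero hq
  obtain ⟨C, hC0, hC⟩ := exists_norm_le_of_tendsto (tendsto_qFact hq)
  obtain ⟨D, hD0, hD⟩ := exists_norm_le_of_tendsto ((tendsto_qFact hq).inv₀ h0)
  have hD' : ∀ m, ‖qFactInv q m‖ ≤ D := by
    rintro (m | m)
    · exact hD m
    · simpa [qFactInv] using hD0
  have h1 := tendsto_tsum_of_dominated_convergence (𝓕 := atTop)
    (f := fun (N : ℕ) (n : ℤ) => qFact q (2 * N) * qFactInv q (N - n) * qFactInv q (N + n) *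
        (thetaCoeff q n * x ^ n))
    (g := fun n => qInf q q * (qInf q q)⁻¹ * (qInf q q)⁻¹ * (thetaCoeff q n * x ^ n))
    ((summable_thetaCoeff hq0 hq hx).mul_left (C * D * D))
    (fun n => by
      refine Tendsto.mul_const _ (((tendsto_qFact hq).comp
        (tendsto_id.const_mul_atTop' two_pos)).mul ((tendsto_qFactInv hq).comp ?_) |>.mul
        ((tendsto_qFactInv hq).comp ?_))
      · exact tendsto_atTop_add_const_right _ _ tendsto_natCast_atTop_atTop
      · exact tendsto_atTop_add_const_right _ _ tendsto_natCast_atTop_atTop)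
    (Eventually.of_forall fun N n => by
      rw [norm_mul, norm_mul, norm_mul]
      gcongr
      exacts [hC _, hD' _, hD' _])
  have h2 := tendsto_nhds_unique
    (h1.congr fun N => (hasSum_finite_triple_product hq0 hq hx N).tsum_eq)
    ((tendsto_prod_qInf hq x).mul (tendsto_prod_qInf hq (q / x)))
  rw [← h2, tsum_mul_left, mul_inv_cancel₀ h0, one_mul, theta, div_eq_inv_mul]
  rfl

/-! ### Well-poised quotients -/

/-- The product `∏_{k < n} (B - q ^ k) / (1 - a B q ^ (k + 1))`, which is
`b⁻ⁿ (b; q)_n / (a q / b; q)_n` for `B = b⁻¹`. -/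
def wpNat (q a B : ℂ) (n : ℕ) : ℂ :=
  ∏ k ∈ range n, (B - q ^ k) / (1 - a * B * q ^ (k + 1))

/-- The well-poised quotient `b⁻ⁿ (b; q)_n / (a q / b; q)_n` for integers `n`, as a function of
`B = b⁻¹` that is regular at `B = 0`. -/
def wp (q a B : ℂ) : ℤ → ℂ
  | Int.ofNat n => wpNat q a B n
  | Int.negSucc n => q ^ (n + 1) * wpNat q a⁻¹ (a * B) (n + 1)

/-- No denominator of `wp q a B` vanishes. -/
def WpRegular (q a B : ℂ) : Prop :=
  ∀ k : ℕ, B * q ^ (k + 1) ≠ 1 ∧ a * B * q ^ (k + 1) ≠ 1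

theorem WpRegular.shift {q a B : ℂ} (h : WpRegular q a B) : WpRegular q a (q * B) := fun k => by
  refine ⟨?_, ?_⟩
  · convert (h (k + 1)).1 using 1
    ring
  · convert (h (k + 1)).2 using 1
    ring

theorem wpRegular_zero (q a : ℂ) : WpRegular q a 0 := fun k => by simp

theorem wpNat_succ (q a B : ℂ) (n : ℕ) :
    wpNat q a B (n + 1) = wpNat q a B n * ((B - q ^ n) / (1 - a * B * q ^ (n + 1))) :=
  prod_range_succ _ _

@[simp] theorem wp_natCast (q a B : ℂ) (n : ℕ) : wp q a B n = wpNat q a B n := rfl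

@[simp] theorem wp_zero (q a B : ℂ) : wp q a B 0 = 1 := by
  change wpNat q a B 0 = 1
  simp [wpNat]

/-- The reflection n ↦ -n sends (a, B) to (1/a, aB), so the negative half of every bilateral sum is
again a unilateral sum of the same type. -/
theorem wp_neg_natCast (q a B : ℂ) (n : ℕ) :
    wp q a B (-n) = q ^ n * wpNat q a⁻¹ (a * B) n := by
  cases n with
  | zero => simp [wpNat]
  | succ n => rfl

theorem wp_succ {q a B : ℂ} (hq0 : q ≠ 0) (ha : a ≠ 0) (h : WpRegular q a B) (n : ℤ) :
    wp q a B (n + 1) * (1 - a * B * q ^ (n + 1)) = wp q a B n * (B - q ^ n) := by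
  have key : ∀ m : ℕ, wp q a B (-m) * (1 - a * B * q ^ (-m : ℤ)) =
      wp q a B (-(m + 1 : ℕ)) * (B - q ^ (-(m + 1 : ℕ) : ℤ)) := by
    intro m
    have h1 := sub_ne_zero.2 (h m).1.symm
    have h2 := pow_ne_zero m hq0
    rw [wp_neg_natCast, wp_neg_natCast, wpNat_succ, zpow_neg, zpow_neg, zpow_natCast,
      zpow_natCast, inv_mul_cancel_left₀ ha, pow_succ]
    rw [pow_succ] at h1
    generalize q ^ m = X at *
    rw [show B - (X * q)⁻¹ = -(1 - B * (X * q)) / (X * q) by field_simp; ring]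
    generalize 1 - B * (X * q) = D at *
    field_simp
    ring
  obtain ⟨m, rfl | rfl⟩ := n.eq_nat_or_neg
  · have h1 := sub_ne_zero.2 (h m).2.symm
    rw [← Nat.cast_succ, wp_natCast, wp_natCast, wpNat_succ, zpow_natCast, zpow_natCast, mul_assoc,
      div_mul_cancel₀ _ h1]
  · cases m with
    | zero =>
      have h1 := sub_ne_zero.2 (h 0).2.symm
      change wp q a B (1 : ℕ) * _ = wp q a B (0 : ℕ) * _
      rw [wp_natCast, wp_natCast, wpNat_succ, mul_assoc]
      simp only [zero_add] at h1
      simp only [Nat.cast_zero, neg_zero, zero_add, zpow_one, pow_zero, pow_one, zpow_zero] at *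
      rw [div_mul_cancel₀ _ h1]
    | succ m =>
      rw [← key m]
      congr 2 <;> push_cast <;> ring_nf

/-- Contiguity of the well-poised quotients for `B` and `q B`. -/
theorem wp_shift {q a B : ℂ} (hq0 : q ≠ 0) (ha : a ≠ 0) (h : WpRegular q a B) (n : ℤ) :
    wp q a B n * (q ^ n * ((1 - q * B) * (1 - a * (q * B)))) =
      wp q a (q * B) n * ((q ^ n - q * B) * (1 - a * (q * B) * q ^ n)) := by
  -- Both sides obey first-order recursions in n and agree at n = 0; regularity makes the factors to
  -- be cancelled nonzero in either direction.
  induction n using Int.induction_on with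
  | zero => simp
  | succ n ih =>
    have e1 := wp_succ hq0 ha h n
    have e2 := wp_succ hq0 ha h.shift n
    have h1 := sub_ne_zero.2 (h n).2.symm
    have hn := zpow_add_one₀ hq0 (n : ℤ)
    have h1' : 1 - a * B * q ^ ((n : ℤ) + 1) ≠ 0 := by exact_mod_cast h1
    refine mul_right_cancel₀ h1' ?_
    rw [hn] at e1 e2 ⊢
    generalize q ^ (n : ℤ) = X at *
    linear_combination (X * q * ((1 - q * B) * (1 - a * (q * B)))) * e1 +
      ((B - X) * q) * ih - ((X * q - q * B) * (1 - a * B * (X * q))) * e2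
  | pred n ih =>
    have e1 := wp_succ hq0 ha h (-(n : ℤ) - 1)
    have e2 := wp_succ hq0 ha h.shift (-(n : ℤ) - 1)
    rw [sub_add_cancel] at e1 e2
    have h1 : B - q ^ (-(n : ℤ) - 1) ≠ 0 := by
      intro h0
      refine (h n).1 ?_
      rw [sub_eq_zero.1 h0, ← zpow_natCast, ← zpow_add₀ hq0]
      simp
    have hn := zpow_add_one₀ hq0 (-(n : ℤ) - 1)
    rw [sub_add_cancel] at hn
    refine mul_right_cancel₀ h1 ?_
    rw [hn] at ih e1 e2
    generalize q ^ (-(n : ℤ) - 1) = X at *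
    refine mul_left_cancel₀ hq0 ?_
    linear_combination (-(X * q * ((1 - q * B) * (1 - a * (q * B))))) * e1 +
      ((1 - a * B * (X * q))) * ih + ((X * q - q * B) * (1 - a * B * (X * q))) * e2

theorem wp_inv_eq {q a b : ℂ} (hq0 : q ≠ 0) (ha : a ≠ 0) (hb : b ≠ 0) (n : ℤ) :
    wp q a b⁻¹ n = qPoch q b n / qPoch q (a * q / b) n * b⁻¹ ^ n := by
  cases n with
  | ofNat n =>
    simp only [wp, wpNat, qPoch, Int.ofNat_eq_natCast, zpow_natCast]
    rw [← prod_div_distrib, ← card_range n, ← prod_const, card_range, ← prod_mul_distrib]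
    refine prod_congr rfl fun k _ => ?_
    have : a * q / b * q ^ k = a * b⁻¹ * q ^ (k + 1) := by ring
    rw [this]
    field_simp
  | negSucc n =>
    simp only [wp, wpNat, qPoch, zpow_negSucc]
    rw [div_eq_mul_inv, inv_inv, ← inv_pow, inv_inv, ← prod_inv_distrib]
    have hc : ∀ y : ℂ, y ^ (n + 1) = ∏ k ∈ range (n + 1), y := by simp
    rw [hc q, hc b, ← prod_mul_distrib, ← prod_mul_distrib, ← prod_mul_distrib]
    refine prod_congr rfl fun k _ => ?_
    rw [inv_mul_cancel_left₀ ha]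
    have h2 := pow_ne_zero k hq0
    -- At this pole both sides are 0 by the convention for division by zero, so no regularity is
    -- needed.
    by_cases h : b = q ^ (k + 1)
    · have : b⁻¹ * q ^ (k + 1) = 1 := by rw [← h, inv_mul_cancel₀ hb]
      rw [this, ← h, div_self hb]
      simp
    · have h3 : 1 - b⁻¹ * q ^ (k + 1) ≠ 0 := by
        rw [sub_ne_zero]
        intro h4
        field_simp at h4
        exact h h4
      have h4 : 1 - b / q ^ (k + 1) ≠ 0 := by
        rw [sub_ne_zero]
        intro h4
        have := pow_ne_zero (k + 1) hq0
        field_simp at h4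
        exact h h4.symm
      rw [mul_div_assoc', div_eq_iff h3]
      have h5 : b - q * q ^ k ≠ 0 := by
        rw [sub_ne_zero, ← pow_succ']
        exact h
      rw [pow_succ] at h3 h4 ⊢
      generalize q ^ k = X at *
      rw [show 1 - b / (X * q) = -(b / (X * q)) * (1 - b⁻¹ * (X * q)) by
        field_simp; ring, mul_inv]
      field_simp
      ring

/-! ### Convergence of well-poised sums and their limits as B, C → 0 -/

/-- Ratio test: consecutive quotients of `wpNat q a B` tend to B, so the ratio of terms tends to
yBC. -/
theorem summable_norm_wpNat {q a B C y : ℂ} (hq : ‖q‖ < 1) (hy : ‖y * B * C‖ < 1) :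
    Summable fun n : ℕ => ‖y ^ n * (wpNat q a B n * wpNat q a C n)‖ := by
  refine summable_of_ratio_tendsto
    (ρ := y * (((B - 0) / (1 - a * B * 0)) * ((C - 0) / (1 - a * C * 0))))
    (r := fun n => y * ((B - q ^ n) / (1 - a * B * q ^ (n + 1)) *
      ((C - q ^ n) / (1 - a * C * q ^ (n + 1))))) (fun n => ?_) ?_ ?_
  · rw [wpNat_succ, wpNat_succ]
    ring
  · have h := tendsto_pow_zero hq
    have h' := h.comp (tendsto_add_atTop_nat 1)
    exact ((((tendsto_const_nhds.sub h).div (tendsto_const_nhds.sub (h'.const_mul (a * B)))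
      (by simp)).mul ((tendsto_const_nhds.sub h).div
      (tendsto_const_nhds.sub (h'.const_mul (a * C))) (by simp)))).const_mul y
  · simpa [mul_assoc] using hy

theorem summable_norm_wpNat_mul {q a B C y l : ℂ} {v : ℕ → ℂ} (hq : ‖q‖ < 1)
    (hy : ‖y * B * C‖ < 1) (hv : Tendsto v atTop (𝓝 l)) :
    Summable fun n : ℕ => y ^ n * (wpNat q a B n * wpNat q a C n) * v n := by
  obtain ⟨M, -, hM⟩ := exists_norm_le_of_tendsto hv
  refine Summable.of_norm_bounded ((summable_norm_wpNat (a := a) hq hy).mul_right M) fun n => ?_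
  rw [norm_mul]
  exact mul_le_mul_of_nonneg_left (hM n) (norm_nonneg _)

/-- A majorant uniform in small B, needed for dominated convergence: the condition on ε keeps every
denominator at least 1/2 in norm. -/
theorem norm_wpNat_le {q a B : ℂ} {ε : ℝ} (hq : ‖q‖ < 1) (hB : ‖B‖ ≤ ε) (hε : ‖a‖ * ε ≤ 1 / 2)
    (n : ℕ) : ‖wpNat q a B n‖ ≤ ∏ k ∈ range n, 2 * (ε + ‖q‖ ^ k) := by
  rw [wpNat, norm_prod]
  refine prod_le_prod (fun _ _ => norm_nonneg _) fun k _ => ?_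
  have h1 : ‖a * B * q ^ (k + 1)‖ ≤ 1 / 2 := by
    rw [norm_mul, norm_mul, norm_pow]
    calc ‖a‖ * ‖B‖ * ‖q‖ ^ (k + 1) ≤ ‖a‖ * ‖B‖ * 1 := by
          gcongr
          exact pow_le_one₀ (norm_nonneg _) hq.le
      _ ≤ ‖a‖ * ε := by rw [mul_one]; gcongr
      _ ≤ 1 / 2 := hε
  have h2 : (1 : ℝ) / 2 ≤ ‖1 - a * B * q ^ (k + 1)‖ := by
    have := norm_sub_norm_le (1 : ℂ) (a * B * q ^ (k + 1))
    rw [norm_one] at this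
    linarith
  have h3 : ‖B - q ^ k‖ ≤ ε + ‖q‖ ^ k := by
    have := norm_sub_le B (q ^ k)
    rw [norm_pow] at this
    linarith
  rw [norm_div, div_le_iff₀ (by linarith)]
  have h4 : 0 ≤ ε + ‖q‖ ^ k := (norm_nonneg _).trans h3
  nlinarith

theorem tendsto_wpNat {q a : ℂ} {B : ℕ → ℂ} (hB : Tendsto B atTop (𝓝 0)) (n : ℕ) :
    Tendsto (fun N => wpNat q a (B N) n) atTop (𝓝 (wpNat q a 0 n)) := by
  refine tendsto_finsetProd _ fun k _ => ?_
  exact (hB.sub_const _).div (tendsto_const_nhds.sub ((hB.const_mul a).mul_const _)) (by simp)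

theorem tendsto_tsum_wpNat {q a y l : ℂ} {v : ℕ → ℂ} {B C : ℕ → ℂ} (hq : ‖q‖ < 1)
    (hv : Tendsto v atTop (𝓝 l)) (hB : Tendsto B atTop (𝓝 0)) (hC : Tendsto C atTop (𝓝 0)) :
    Tendsto (fun N => ∑' n : ℕ, y ^ n * (wpNat q a (B N) n * wpNat q a (C N) n) * v n) atTop
      (𝓝 (∑' n : ℕ, y ^ n * (wpNat q a 0 n * wpNat q a 0 n) * v n)) := by
  obtain ⟨M, -, hM⟩ := exists_norm_le_of_tendsto hv
  -- The first bound is the one required by `norm_wpNat_le`; the second is the limiting ratio of the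
  -- resulting majorant, which is therefore summable for every y.
  obtain ⟨ε, hε0, hε1, hε2⟩ : ∃ ε : ℝ, 0 < ε ∧ ‖a‖ * ε ≤ 1 / 2 ∧ ‖y‖ * (2 * ε) ^ 2 < 1 := by
    have t1 : Tendsto (fun ε : ℝ => ‖a‖ * ε) (𝓝[>] 0) (𝓝 0) := by
      have : Tendsto (fun ε : ℝ => ‖a‖ * ε) (𝓝 0) (𝓝 (‖a‖ * 0)) := by
        apply Continuous.tendsto
        fun_prop
      rw [mul_zero] at this
      exact this.mono_left nhdsWithin_le_nhds
    have t2 : Tendsto (fun ε : ℝ => ‖y‖ * (2 * ε) ^ 2) (𝓝[>] 0) (𝓝 0) := by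
      have : Tendsto (fun ε : ℝ => ‖y‖ * (2 * ε) ^ 2) (𝓝 0) (𝓝 (‖y‖ * (2 * 0) ^ 2)) := by
        apply Continuous.tendsto
        fun_prop
      simp only [mul_zero, ne_eq, OfNat.ofNat_ne_zero, not_false_eq_true, zero_pow] at this
      exact this.mono_left nhdsWithin_le_nhds
    obtain ⟨ε, h1, h2, h3⟩ := ((eventually_mem_nhdsWithin (a := (0 : ℝ)) (s := Set.Ioi 0)).and
      ((t1.eventually_le_const (by norm_num : (0 : ℝ) < 1 / 2)).and
        (t2.eventually_lt_const one_pos))).exists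
    exact ⟨ε, h1, h2, h3⟩
  set D : ℕ → ℝ := fun n => ∏ k ∈ range n, 2 * (ε + ‖q‖ ^ k) with hD
  have hD0 : ∀ n, 0 ≤ D n := fun n => prod_nonneg fun k _ => by positivity
  have hsum : Summable fun n : ℕ => ‖y‖ ^ n * (D n * D n) * M := by
    refine Summable.mul_right M ?_
    have hr : Tendsto (fun n : ℕ => ‖y‖ * (2 * (ε + ‖q‖ ^ n)) ^ 2) atTop
        (𝓝 (‖y‖ * (2 * (ε + 0)) ^ 2)) :=
      (((tendsto_pow_atTop_nhds_zero_of_lt_one (norm_nonneg q) hq).const_add ε).const_mul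
        2 |>.pow 2).const_mul _
    rw [add_zero] at hr
    obtain ⟨s, hs1, hs2⟩ := exists_between hε2
    refine summable_of_ratio_norm_eventually_le hs2 ?_
    filter_upwards [hr.eventually_lt_const hs1] with n hn
    have e : ‖y‖ ^ (n + 1) * (D (n + 1) * D (n + 1)) =
        ‖y‖ * (2 * (ε + ‖q‖ ^ n)) ^ 2 * (‖y‖ ^ n * (D n * D n)) := by
      rw [hD]
      simp only [prod_range_succ]
      ring
    have h0 : 0 ≤ ‖y‖ ^ n * (D n * D n) := by
      have := hD0 n
      positivity
    rw [e, norm_mul, Real.norm_of_nonneg h0, Real.norm_of_nonneg (by positivity)]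
    exact mul_le_mul_of_nonneg_right hn.le h0
  refine tendsto_tsum_of_dominated_convergence hsum (fun n =>
    (((tendsto_wpNat hB n).mul (tendsto_wpNat hC n)).const_mul _).mul_const _) ?_
  have small : ∀ {B : ℕ → ℂ}, Tendsto B atTop (𝓝 0) → ∀ᶠ N in atTop, ‖B N‖ ≤ ε := fun h =>
    (by simpa using h.norm : Tendsto (fun N => ‖_‖) atTop (𝓝 0)).eventually_le_const hε0
  filter_upwards [small hB, small hC] with N h1 h2 n
  rw [norm_mul, norm_mul, norm_mul, norm_pow]
  have := hD0 n
  gcongr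
  exacts [norm_wpNat_le hq h1 hε1 n, norm_wpNat_le hq h2 hε1 n, hM n]

/-! ### The ₆ψ₆ series with a = de -/

/-- The quotient `(d; q)_n / (d q; q)_n = (1 - d) / (1 - d q ^ n)`. -/
def ratioFactor (q d : ℂ) (n : ℤ) : ℂ := if n = 0 then 1 else (1 - d) / (1 - d * q ^ n)

/-- `d` is not an integer power of `q`, except possibly `q ^ 0`. -/
def AvoidsPowers (q d : ℂ) : Prop := ∀ n : ℤ, n ≠ 0 → d * q ^ n ≠ 1

theorem AvoidsPowers.inv {q d : ℂ} (hq0 : q ≠ 0) (hd0 : d ≠ 0) (h : AvoidsPowers q d) :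
    AvoidsPowers q d⁻¹ := fun n hn h1 => h (-n) (neg_ne_zero.2 hn) (by
  have := zpow_ne_zero n hq0
  rw [zpow_neg]
  field_simp at h1 ⊢
  exact h1.symm)

theorem AvoidsPowers.qInf_ne_zero {q d : ℂ} (hq : ‖q‖ < 1) (h : AvoidsPowers q d) :
    qInf q (d * q) ≠ 0 := QSeries.qInf_ne_zero hq fun k => by
  rw [mul_assoc, ← pow_succ', ← zpow_natCast]
  exact h _ (by omega)

theorem ratioFactor_mul {q d : ℂ} (h : AvoidsPowers q d) (n : ℤ) :
    ratioFactor q d n * (1 - d * q ^ n) = 1 - d := by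
  unfold ratioFactor
  split_ifs with hn
  · simp [hn]
  · exact div_mul_cancel₀ _ (sub_ne_zero.2 (h n hn).symm)

theorem ratioFactor_neg {q d : ℂ} (hq0 : q ≠ 0) (hd0 : d ≠ 0) (n : ℤ) :
    ratioFactor q d (-n) = q ^ n * ratioFactor q d⁻¹ n := by
  unfold ratioFactor
  simp only [neg_eq_zero]
  split_ifs with hn
  · simp [hn]
  · have h := zpow_ne_zero n hq0
    rw [show 1 - d = -d * (1 - d⁻¹) by field_simp; ring, zpow_neg,
      show 1 - d * (q ^ n)⁻¹ = -d * ((q ^ n)⁻¹ * (1 - d⁻¹ * q ^ n)) by field_simp; ring,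
      mul_div_mul_left _ _ (neg_ne_zero.2 hd0), div_mul_eq_div_div]
    field_simp

theorem tendsto_ratioFactor {q : ℂ} (hq : ‖q‖ < 1) (d : ℂ) :
    Tendsto (fun n : ℕ => ratioFactor q d n) atTop (𝓝 (1 - d)) := by
  have h : Tendsto (fun n : ℕ => (1 - d) / (1 - d * q ^ n)) atTop (𝓝 ((1 - d) / (1 - d * 0))) :=
    tendsto_const_nhds.div (tendsto_const_nhds.sub ((tendsto_pow_zero hq).const_mul d)) (by simp)
  rw [mul_zero, sub_zero, div_one] at h
  refine h.congr' ?_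
  filter_upwards [eventually_gt_atTop 0] with n hn
  rw [ratioFactor, if_neg (by omega), zpow_natCast]

/-- The weight `(1 - a q ^ (2 n)) (d, e; q)_n / (d q, e q; q)_n` with `a = d e`. -/
def pairWeight (q d e : ℂ) (n : ℤ) : ℂ :=
  (1 - d * e * (q ^ n) ^ 2) * (ratioFactor q d n * ratioFactor q e n)

theorem pairWeight_zero (q d e : ℂ) : pairWeight q d e 0 = 1 - d * e := by
  simp [pairWeight, ratioFactor]

theorem pairWeight_neg {q d e : ℂ} (hq0 : q ≠ 0) (hd0 : d ≠ 0) (he0 : e ≠ 0) (n : ℤ) :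
    pairWeight q d e (-n) = -(d * e) * pairWeight q d⁻¹ e⁻¹ n := by
  rw [pairWeight, pairWeight, ratioFactor_neg hq0 hd0, ratioFactor_neg hq0 he0, zpow_neg]
  have := zpow_ne_zero n hq0
  field_simp
  ring

theorem tendsto_pairWeight {q : ℂ} (hq : ‖q‖ < 1) (d e : ℂ) :
    Tendsto (fun n : ℕ => pairWeight q d e n) atTop
      (𝓝 ((1 - d * e * 0 ^ 2) * ((1 - d) * (1 - e)))) := by
  refine Tendsto.mul ?_ ((tendsto_ratioFactor hq d).mul (tendsto_ratioFactor hq e))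
  simp only [zpow_natCast]
  exact tendsto_const_nhds.sub (((tendsto_pow_zero hq).pow 2).const_mul _)

/-- The terms of the very-well-poised `₆ψ₆` series with parameters `a = d e`, `b = B⁻¹`, `c = C⁻¹`,
`d`, `e`, multiplied by `1 - a`. -/
def pairTerm (q d e B C : ℂ) (n : ℤ) : ℂ :=
  (d * e * q) ^ n * (wp q (d * e) B n * wp q (d * e) C n) * pairWeight q d e n

theorem pairTerm_comm (q d e B C : ℂ) : pairTerm q d e B C = pairTerm q d e C B := by
  funext n
  rw [pairTerm, pairTerm, mul_comm (wp _ _ B n)]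

theorem pairTerm_natCast (q d e B C : ℂ) (n : ℕ) :
    pairTerm q d e B C n =
      (d * e * q) ^ n * (wpNat q (d * e) B n * wpNat q (d * e) C n) * pairWeight q d e n := by
  simp [pairTerm]

theorem pairTerm_zero (q d e B C : ℂ) : pairTerm q d e B C 0 = 1 - d * e := by
  simp [pairTerm, pairWeight_zero]

theorem pairTerm_neg {q d e : ℂ} (hq0 : q ≠ 0) (hd0 : d ≠ 0) (he0 : e ≠ 0) (B C : ℂ) (n : ℕ) :
    pairTerm q d e B C (-n) = -(d * e) * pairTerm q d⁻¹ e⁻¹ (d * e * B) (d * e * C) n := by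
  rw [pairTerm_natCast, pairTerm, pairWeight_neg hq0 hd0 he0, wp_neg_natCast, wp_neg_natCast,
    zpow_neg, zpow_natCast, mul_inv d e, mul_pow, mul_pow, mul_pow, mul_pow]
  simp only [inv_pow]
  have := pow_ne_zero n hq0
  field_simp

/-- The convergence condition is invariant under the reflection of `pairTerm_neg`, so one inequality
serves both halves of the series. -/
theorem norm_reflect {d e q B C : ℂ} (hd0 : d ≠ 0) (he0 : e ≠ 0)
    (h : ‖d * e * q * B * C‖ < 1) : ‖d⁻¹ * e⁻¹ * q * (d * e * B) * (d * e * C)‖ < 1 := by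
  convert h using 2
  field_simp

theorem summable_pairTerm_nat {q d e B C : ℂ} (hq : ‖q‖ < 1) (h : ‖d * e * q * B * C‖ < 1) :
    Summable fun n : ℕ => pairTerm q d e B C n := by
  simp only [pairTerm_natCast]
  exact summable_norm_wpNat_mul hq h (tendsto_pairWeight hq d e)

theorem summable_pairTerm_neg {q d e B C : ℂ} (hq0 : q ≠ 0) (hq : ‖q‖ < 1) (hd0 : d ≠ 0)
    (he0 : e ≠ 0) (h : ‖d * e * q * B * C‖ < 1) :
    Summable fun n : ℕ => pairTerm q d e B C (-n) := by
  simp only [pairTerm_neg hq0 hd0 he0]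
  exact (summable_pairTerm_nat hq (norm_reflect hd0 he0 h)).mul_left _

theorem summable_pairTerm {q d e B C : ℂ} (hq0 : q ≠ 0) (hq : ‖q‖ < 1) (hd0 : d ≠ 0)
    (he0 : e ≠ 0) (h : ‖d * e * q * B * C‖ < 1) : Summable (pairTerm q d e B C) :=
  Summable.of_nat_of_neg (summable_pairTerm_nat hq h) (summable_pairTerm_neg hq0 hq hd0 he0 h)

theorem tsum_pairTerm {q d e B C : ℂ} (hq0 : q ≠ 0) (hq : ‖q‖ < 1) (hd0 : d ≠ 0)
    (he0 : e ≠ 0) (h : ‖d * e * q * B * C‖ < 1) :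
    ∑' n : ℤ, pairTerm q d e B C n = ∑' n : ℕ, pairTerm q d e B C n +
      -(d * e) * ∑' n : ℕ, pairTerm q d⁻¹ e⁻¹ (d * e * B) (d * e * C) n - (1 - d * e) := by
  rw [Summable.tsum_of_nat_of_neg (summable_pairTerm_nat hq h)
    (summable_pairTerm_neg hq0 hq hd0 he0 h), pairTerm_zero, ← tsum_mul_left]
  simp only [pairTerm_neg hq0 hd0 he0]

theorem tendsto_tsum_pairTerm {q d e : ℂ} (hq0 : q ≠ 0) (hq : ‖q‖ < 1) (hd0 : d ≠ 0)
    (he0 : e ≠ 0) {B C : ℕ → ℂ} (hB : Tendsto B atTop (𝓝 0)) (hC : Tendsto C atTop (𝓝 0)) :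
    Tendsto (fun N => ∑' n : ℤ, pairTerm q d e (B N) (C N) n) atTop
      (𝓝 (∑' n : ℤ, pairTerm q d e 0 0 n)) := by
  have key : ∀ (d e : ℂ) {B C : ℕ → ℂ}, Tendsto B atTop (𝓝 0) → Tendsto C atTop (𝓝 0) →
      Tendsto (fun N => ∑' n : ℕ, pairTerm q d e (B N) (C N) n) atTop
        (𝓝 (∑' n : ℕ, pairTerm q d e 0 0 n)) := by
    intro d e B C hB hC
    simp only [pairTerm_natCast]
    exact tendsto_tsum_wpNat hq (tendsto_pairWeight hq d e) hB hC
  have hB' := hB.const_mul (d * e)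
  have hC' := hC.const_mul (d * e)
  have hBC : Tendsto (fun N => ‖d * e * q * B N * C N‖) atTop (𝓝 ‖d * e * q * 0 * 0‖) :=
    ((hB.const_mul _).mul hC).norm
  simp only [mul_zero, norm_zero] at hB' hC' hBC
  rw [tsum_pairTerm hq0 hq hd0 he0 (by simp), mul_zero]
  refine ((((key d e hB hC).add ((key d⁻¹ e⁻¹ hB' hC').const_mul _)).sub_const _)).congr' ?_
  filter_upwards [hBC.eventually_lt_const one_pos] with N hN
  exact (tsum_pairTerm hq0 hq hd0 he0 hN).symm

/-- The telescoping sum behind the contiguous relation. -/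
theorem hasSum_wp_zero {q a B C : ℂ} (hq0 : q ≠ 0) (hq : ‖q‖ < 1) (ha : a ≠ 0)
    (hB : WpRegular q a B) (hC : WpRegular q a C) (h : ‖a * B * C‖ < 1) :
    HasSum (fun n : ℤ => a ^ n * (wp q a B n * wp q a C n) * (1 - a * (q ^ n) ^ 2)) 0 := by
  -- With X = q^n, a(B-X)(C-X) - (1-aBX)(1-aCX) = (aBC-1)(1-aX²), so H(n+1) - H(n) is aBC - 1 times
  -- the summand.
  set H : ℤ → ℂ := fun n => a ^ n * (wp q a B n * wp q a C n) *
    ((1 - a * B * q ^ n) * (1 - a * C * q ^ n)) with hH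
  have h1 : Summable H := by
    refine Summable.of_nat_of_neg ?_ ?_
    · have := summable_norm_wpNat_mul (a := a)
        (v := fun n => (1 - a * B * q ^ n) * (1 - a * C * q ^ n)) hq h
        ((tendsto_const_nhds.sub ((tendsto_pow_zero hq).const_mul (a * B))).mul
        (tendsto_const_nhds.sub ((tendsto_pow_zero hq).const_mul (a * C))))
      simpa [hH] using this
    · have h' : ‖a⁻¹ * (a * B) * (a * C)‖ < 1 := by
        rwa [inv_mul_cancel_left₀ ha, mul_left_comm, ← mul_assoc]
      have := summable_norm_wpNat_mul (a := a⁻¹)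
        (v := fun n => (q ^ n - a * B) * (q ^ n - a * C)) hq h'
        (((tendsto_pow_zero hq).sub_const (a * B)).mul
        ((tendsto_pow_zero hq).sub_const (a * C)))
      refine this.congr fun n => ?_
      have := pow_ne_zero n hq0
      simp only [hH, wp_neg_natCast, zpow_neg, zpow_natCast, inv_pow]
      field_simp
  have h2 : ∑' n : ℤ, H (n + 1) = ∑' n, H n := (Equiv.addRight (1 : ℤ)).tsum_eq H
  have h3 : Summable fun n : ℤ => H (n + 1) := (Equiv.addRight (1 : ℤ)).summable_iff.2 h1
  have h4 := h3.hasSum.sub h1.hasSum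
  rw [h2, sub_self] at h4
  have h5 : a * B * C - 1 ≠ 0 := by
    intro h0
    rw [sub_eq_zero.1 h0, norm_one] at h
    exact lt_irrefl _ h
  have h6 := h4.mul_left (a * B * C - 1)⁻¹
  rw [mul_zero] at h6
  convert h6 using 1
  · rfl
  funext n
  have e1 := wp_succ hq0 ha hB n
  have e2 := wp_succ hq0 ha hC n
  simp only [hH]
  rw [eq_inv_mul_iff_mul_eq₀ h5, zpow_add_one₀ ha, show ∀ u v w z y : ℂ,
    u * (v * w) * (z * y) = u * (v * z) * (w * y) by intros; ring, e1, e2]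
  ring

/-- With t = qB and X = q^n, the factor from `wp_shift` is (X-t)(1-deXt) = (1-dt)(1-et)X -
t(1-dX)(1-eX). The second part cancels the denominators of the weight and leaves the telescoping
summand. -/
theorem pairTerm_contiguous {q d e B C : ℂ} (hq0 : q ≠ 0) (hd0 : d ≠ 0) (he0 : e ≠ 0)
    (hd : AvoidsPowers q d) (he : AvoidsPowers q e) (hB : WpRegular q (d * e) B) (n : ℤ) :
    pairTerm q d e B C n * ((1 - q * B) * (1 - d * e * (q * B))) =
      (1 - d * (q * B)) * (1 - e * (q * B)) * pairTerm q d e (q * B) C n -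
        q * B * (1 - d) * (1 - e) * ((d * e) ^ n * (wp q (d * e) (q * B) n * wp q (d * e) C n) *
          (1 - d * e * (q ^ n) ^ 2)) := by
  have h1 := wp_shift hq0 (mul_ne_zero hd0 he0) hB n
  have h2 := ratioFactor_mul hd n
  have h3 := ratioFactor_mul he n
  rw [pairTerm, pairTerm, pairWeight, mul_zpow _ q, ← h2, ← h3]
  generalize q ^ n = X at *
  generalize ratioFactor q d n = r at *
  generalize ratioFactor q e n = s at *
  linear_combination ((d * e) ^ n * wp q (d * e) C n * (1 - d * e * X ^ 2) * r * s) * h1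

theorem tsum_pairTerm_contiguous {q d e B C : ℂ} (hq0 : q ≠ 0) (hq : ‖q‖ < 1) (hd0 : d ≠ 0)
    (he0 : e ≠ 0) (hd : AvoidsPowers q d) (he : AvoidsPowers q e)
    (hB : WpRegular q (d * e) B) (hC : WpRegular q (d * e) C) (h : ‖d * e * q * B * C‖ < 1) :
    (∑' n, pairTerm q d e B C n) * ((1 - q * B) * (1 - d * e * (q * B))) =
      (1 - d * (q * B)) * (1 - e * (q * B)) * ∑' n, pairTerm q d e (q * B) C n := by
  have h' : ‖d * e * (q * B) * C‖ < 1 := by rwa [← mul_assoc]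
  have h'' : ‖d * e * q * (q * B) * C‖ < 1 := by
    rw [show d * e * q * (q * B) * C = q * (d * e * (q * B) * C) by ring, norm_mul]
    nlinarith [norm_nonneg q, norm_nonneg (d * e * (q * B) * C)]
  have h1 := hasSum_wp_zero hq0 hq (mul_ne_zero hd0 he0) hB.shift hC h'
  have h2 := (summable_pairTerm hq0 hq hd0 he0 h'').hasSum
  have h3 := (summable_pairTerm hq0 hq hd0 he0 h).hasSum
  refine (h3.mul_right _).unique ?_
  have h4 := (h2.mul_left ((1 - d * (q * B)) * (1 - e * (q * B)))).sub
    (h1.mul_left (q * B * (1 - d) * (1 - e)))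
  rw [mul_zero, sub_zero] at h4
  convert h4 using 1
  · rfl
  funext n
  exact pairTerm_contiguous hq0 hd0 he0 hd he hB n

theorem WpRegular.shift_pow {q a B : ℂ} (h : WpRegular q a B) (N : ℕ) :
    WpRegular q a (q ^ N * B) := by
  induction N with
  | zero => simpa using h
  | succ N ih =>
    rw [pow_succ', mul_assoc]
    exact ih.shift

theorem tsum_pairTerm_iterate {q d e B C : ℂ} (hq0 : q ≠ 0) (hq : ‖q‖ < 1) (hd0 : d ≠ 0)
    (he0 : e ≠ 0) (hd : AvoidsPowers q d) (he : AvoidsPowers q e)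
    (hB : WpRegular q (d * e) B) (hC : WpRegular q (d * e) C) (h : ‖d * e * q * B * C‖ < 1)
    (N : ℕ) :
    (∑' n, pairTerm q d e B C n) *
        ((∏ k ∈ range N, (1 - q * B * q ^ k)) * ∏ k ∈ range N, (1 - d * e * (q * B) * q ^ k)) =
      ((∏ k ∈ range N, (1 - d * (q * B) * q ^ k)) * ∏ k ∈ range N, (1 - e * (q * B) * q ^ k)) *
        ∑' n, pairTerm q d e (q ^ N * B) C n := by
  induction N with
  | zero => simp
  | succ N ih =>
    have h' : ‖d * e * q * (q ^ N * B) * C‖ < 1 := by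
      rw [show d * e * q * (q ^ N * B) * C = q ^ N * (d * e * q * B * C) by ring, norm_mul,
        norm_pow]
      nlinarith [norm_nonneg q, norm_nonneg (d * e * q * B * C),
        pow_le_one₀ (n := N) (norm_nonneg q) hq.le, pow_nonneg (norm_nonneg q) N]
    have h1 := tsum_pairTerm_contiguous hq0 hq hd0 he0 hd he (hB.shift_pow N) hC h'
    rw [← mul_assoc q (q ^ N), ← pow_succ'] at h1
    rw [prod_range_succ, prod_range_succ, prod_range_succ, prod_range_succ]
    rw [pow_succ] at h1 ⊢
    linear_combination ((1 - q * B * q ^ N) * (1 - d * e * (q * B) * q ^ N)) * ih +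
      ((∏ k ∈ range N, (1 - d * (q * B) * q ^ k)) * ∏ k ∈ range N, (1 - e * (q * B) * q ^ k)) * h1

/-- Shift B by q^N, then C by q^N using the symmetry in B and C, and let N → ∞; all dependence on B
and C moves into the products. -/
theorem tsum_pairTerm_reduce {q d e B C : ℂ} (hq0 : q ≠ 0) (hq : ‖q‖ < 1) (hd0 : d ≠ 0)
    (he0 : e ≠ 0) (hd : AvoidsPowers q d) (he : AvoidsPowers q e)
    (hB : WpRegular q (d * e) B) (hC : WpRegular q (d * e) C) (h : ‖d * e * q * B * C‖ < 1) :
    (∑' n, pairTerm q d e B C n) * (qInf q (q * B) * qInf q (d * e * (q * B)) *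
        (qInf q (q * C) * qInf q (d * e * (q * C)))) =
      qInf q (d * (q * B)) * qInf q (e * (q * B)) * (qInf q (d * (q * C)) * qInf q (e * (q * C))) *
        ∑' n, pairTerm q d e 0 0 n := by
  have t0 : ∀ X : ℂ, Tendsto (fun N : ℕ => q ^ N * X) atTop (𝓝 0) := fun X => by
    simpa using (tendsto_pow_zero hq).mul_const X
  have t := tendsto_prod_qInf hq
  refine tendsto_nhds_unique ((((t (q * B)).mul (t (d * e * (q * B)))).mul
    ((t (q * C)).mul (t (d * e * (q * C))))).const_mul (∑' n, pairTerm q d e B C n)) ?_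
  refine ((((t (d * (q * B))).mul (t (e * (q * B)))).mul ((t (d * (q * C))).mul
    (t (e * (q * C))))).mul (tendsto_tsum_pairTerm hq0 hq hd0 he0 (t0 B) (t0 C))).congr fun N => ?_
  have h' : ‖d * e * q * C * (q ^ N * B)‖ < 1 := by
    rw [show d * e * q * C * (q ^ N * B) = q ^ N * (d * e * q * B * C) by ring, norm_mul,
      norm_pow]
    nlinarith [norm_nonneg q, norm_nonneg (d * e * q * B * C),
      pow_le_one₀ (n := N) (norm_nonneg q) hq.le, pow_nonneg (norm_nonneg q) N]
  have h1 := tsum_pairTerm_iterate hq0 hq hd0 he0 hd he hB hC h N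
  have h2 := tsum_pairTerm_iterate hq0 hq hd0 he0 hd he hC (hB.shift_pow N) h' N
  rw [pairTerm_comm q d e C, pairTerm_comm q d e (q ^ N * C)] at h2
  linear_combination (-((∏ k ∈ range N, (1 - q * C * q ^ k)) *
    ∏ k ∈ range N, (1 - d * e * (q * C) * q ^ k))) * h1 -
    ((∏ k ∈ range N, (1 - d * (q * B) * q ^ k)) * ∏ k ∈ range N, (1 - e * (q * B) * q ^ k)) * h2

theorem wpNat_one_eq_zero (q a : ℂ) {n : ℕ} (hn : n ≠ 0) : wpNat q a 1 n = 0 :=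
  prod_eq_zero (mem_range.2 (Nat.pos_of_ne_zero hn)) (by simp)

/-- B = 1 kills the terms with n > 0, and by reflection C = 1/a kills those with n < 0. -/
theorem tsum_pairTerm_one_inv {q d e : ℂ} (hd0 : d ≠ 0) (he0 : e ≠ 0) :
    ∑' n, pairTerm q d e 1 (d * e)⁻¹ n = 1 - d * e := by
  rw [tsum_eq_single 0, pairTerm_zero]
  intro n hn
  obtain ⟨m, rfl | rfl⟩ := n.eq_nat_or_neg
  · rw [pairTerm_natCast, wpNat_one_eq_zero _ _ (by simpa using hn)]
    simp
  · rw [pairTerm, wp_neg_natCast _ _ (d * e)⁻¹, mul_inv_cancel₀ (mul_ne_zero hd0 he0),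
      wpNat_one_eq_zero _ _ (by simpa using hn)]
    simp

/-- At B = 0 the quotient is (-1)^n q^(n(n-1)/2); squaring removes the sign. -/
theorem wp_zero_sq {q a : ℂ} (hq0 : q ≠ 0) (ha : a ≠ 0) (n : ℤ) :
    (a * q) ^ n * (wp q a 0 n * wp q a 0 n) = a ^ n * q ^ (n * n) := by
  have step : ∀ n, wp q a 0 (n + 1) = -(wp q a 0 n * q ^ n) := fun n => by
    have := wp_succ hq0 ha (wpRegular_zero q a) n
    simpa using this
  have haq := mul_ne_zero ha hq0
  induction n using Int.induction_on with
  | zero => simp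
  | succ n ih =>
    rw [step, zpow_add_one₀ haq, zpow_add_one₀ ha,
      show ((n : ℤ) + 1) * (n + 1) = n * n + n + n + 1 by ring, zpow_add_one₀ hq0, zpow_add₀ hq0,
      zpow_add₀ hq0]
    linear_combination (a * q * q ^ (n : ℤ) * q ^ (n : ℤ)) * ih
  | pred n ih =>
    have h := step (-(n : ℤ) - 1)
    rw [sub_add_cancel] at h
    have hq := zpow_ne_zero (-(n : ℤ) - 1) hq0
    have e1 : (a * q) ^ (-(n : ℤ)) = (a * q) ^ (-(n : ℤ) - 1) * (a * q) := by
      rw [← zpow_add_one₀ haq, sub_add_cancel]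
    have e2 : a ^ (-(n : ℤ)) = a ^ (-(n : ℤ) - 1) * a := by
      rw [← zpow_add_one₀ ha, sub_add_cancel]
    have e3 : q ^ (-(n : ℤ) * -(n : ℤ)) = q ^ ((-(n : ℤ) - 1) * (-(n : ℤ) - 1)) *
        (q ^ (-(n : ℤ) - 1) * q ^ (-(n : ℤ) - 1) * q) := by
      rw [← zpow_add₀ hq0, ← zpow_add_one₀ hq0, ← zpow_add₀ hq0]
      congr 1
      ring
    rw [h, e1, e2, e3] at ih
    refine mul_right_cancel₀ (mul_ne_zero (mul_ne_zero ha hq0) (mul_ne_zero hq hq)) ?_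
    linear_combination ih

/-- If `d e` is an integer power of `q`, the limiting sum vanishes by antisymmetry. -/
theorem tsum_pairTerm_zero_of_zpow {q d e : ℂ} (hq0 : q ≠ 0) (hd0 : d ≠ 0) (he0 : e ≠ 0)
    (hd : AvoidsPowers q d) (he : AvoidsPowers q e) {m : ℤ} (hm : m ≠ 0) (hde : d * e = q ^ m) :
    ∑' n, pairTerm q d e 0 0 n = 0 := by
  have key : ∀ {d e : ℂ}, AvoidsPowers q d → AvoidsPowers q e → d * e = q ^ m →
      ∀ n, ratioFactor q d n = (1 - d) / (1 - d * q ^ n) := by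
    intro d e hd he hde n
    rw [ratioFactor]
    split_ifs with hn
    · have : d ≠ 1 := by
        rintro rfl
        refine he (-m) (neg_ne_zero.2 hm) ?_
        rw [one_mul] at hde
        rw [hde, ← zpow_add₀ hq0]
        simp
      rw [hn, zpow_zero, mul_one, div_self (sub_ne_zero.2 this.symm)]
    · rfl
  -- This reflection replaces X = q^n by 1/(aX) and fixes a^n q^(n²), because a = q^m.
  have hodd : ∀ n, pairTerm q d e 0 0 (-m - n) = -pairTerm q d e 0 0 n := by
    intro n
    have hX := zpow_ne_zero n hq0
    have hA := zpow_ne_zero m hq0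
    rw [pairTerm, pairTerm, wp_zero_sq hq0 (mul_ne_zero hd0 he0),
      wp_zero_sq hq0 (mul_ne_zero hd0 he0), pairWeight, pairWeight, key hd he hde,
      key he hd (by rw [mul_comm, hde]), key hd he hde, key he hd (by rw [mul_comm, hde])]
    have e1 : (d * e) ^ (-m - n) * q ^ ((-m - n) * (-m - n)) = (d * e) ^ n * q ^ (n * n) := by
      rw [hde, ← zpow_mul, ← zpow_mul, ← zpow_add₀ hq0, ← zpow_add₀ hq0]
      congr 1
      ring
    have e2 : q ^ (-m - n) = (d * e * q ^ n)⁻¹ := by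
      rw [hde, zpow_sub₀ hq0, zpow_neg, mul_inv]
      rfl
    rw [e1, e2]
    generalize q ^ n = X at *
    rw [show 1 - d * (d * e * X)⁻¹ = -(e * X)⁻¹ * (1 - e * X) by field_simp; ring,
      show 1 - e * (d * e * X)⁻¹ = -(d * X)⁻¹ * (1 - d * X) by field_simp; ring]
    simp only [div_eq_mul_inv, mul_inv, inv_neg, inv_inv]
    field_simp
    ring
  have h := (Equiv.subLeft (-m)).tsum_eq (pairTerm q d e 0 0)
  simp only [Equiv.subLeft_apply, hodd, tsum_neg] at h
  exact self_eq_neg.1 h.symm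

/-- Comparing the reduction at B = 1, C = 1/a with the single surviving term gives the constant. If
a is a nonzero power of q this choice is not regular, but then both sides vanish. -/
theorem tsum_pairTerm_zero {q d e : ℂ} (hq0 : q ≠ 0) (hq : ‖q‖ < 1) (hd0 : d ≠ 0)
    (he0 : e ≠ 0) (hd : AvoidsPowers q d) (he : AvoidsPowers q e) :
    (∑' n, pairTerm q d e 0 0 n) * (qInf q (d * q) * qInf q (e * q) *
        (qInf q (q / d) * qInf q (q / e))) =
      (1 - d * e) * (qInf q q * qInf q q * (qInf q (d * e * q) * qInf q (q / (d * e)))) := by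
  by_cases h : AvoidsPowers q (d * e)
  · have ha := mul_ne_zero hd0 he0
    have h' := h.inv hq0 ha
    have hpow : ∀ (x : ℂ) (k : ℕ), AvoidsPowers q x → x * q ^ (k + 1) ≠ 1 := fun x k hx => by
      rw [← zpow_natCast]
      exact hx _ (by omega)
    have h1 := tsum_pairTerm_reduce (B := 1) (C := (d * e)⁻¹) hq0 hq hd0 he0 hd he
      (fun k => ⟨by simpa using pow_succ_ne_one hq k, by simpa using hpow _ k h⟩)
      (fun k => ⟨hpow _ k h', by
        rw [mul_inv_cancel₀ ha, one_mul]
        exact pow_succ_ne_one hq k⟩)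
      (by
        rw [show d * e * q * 1 * (d * e)⁻¹ = q by field_simp]
        exact hq)
    rw [tsum_pairTerm_one_inv hd0 he0] at h1
    rw [show d * (q * (d * e)⁻¹) = q / e by field_simp,
      show e * (q * (d * e)⁻¹) = q / d by field_simp,
      show d * e * (q * (d * e)⁻¹) = q by field_simp, mul_one, ← div_eq_mul_inv] at h1
    linear_combination -h1
  · obtain ⟨n, hn, h1⟩ : ∃ n : ℤ, n ≠ 0 ∧ d * e * q ^ n = 1 := by
      simpa [AvoidsPowers] using h
    have hde' : d * e = q ^ (-n) := by
      rw [zpow_neg]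
      exact eq_inv_of_mul_eq_one_left h1
    rw [tsum_pairTerm_zero_of_zpow hq0 hd0 he0 hd he (neg_ne_zero.2 hn) hde', zero_mul]
    have : qInf q (d * e * q) * qInf q (q / (d * e)) = 0 := by
      obtain ⟨m, rfl | rfl⟩ := n.eq_nat_or_neg
      · obtain ⟨m, rfl⟩ := Nat.exists_eq_succ_of_ne_zero (n := m) (by simpa using hn)
        rw [qInf_eq_zero hq (k := m), zero_mul]
        rw [mul_assoc, ← pow_succ']
        exact_mod_cast h1
      · obtain ⟨m, rfl⟩ := Nat.exists_eq_succ_of_ne_zero (n := m) (by simpa using hn)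
        rw [qInf_eq_zero hq (x := q / (d * e)) (k := m), mul_zero]
        rw [hde', neg_neg, zpow_natCast, div_mul_eq_mul_div, ← pow_succ',
          div_self (pow_ne_zero _ hq0)]
    rw [this]
    ring

/-- Bailey's `₆ψ₆` summation for `a = d e`. -/
theorem tsum_pairTerm_eq {q d e B C : ℂ} (hq0 : q ≠ 0) (hq : ‖q‖ < 1) (hd0 : d ≠ 0)
    (he0 : e ≠ 0) (hd : AvoidsPowers q d) (he : AvoidsPowers q e)
    (hB : WpRegular q (d * e) B) (hC : WpRegular q (d * e) C) (h : ‖d * e * q * B * C‖ < 1) :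
    (∑' n, pairTerm q d e B C n) * (qInf q (q * B) * qInf q (d * e * (q * B)) *
        (qInf q (q * C) * qInf q (d * e * (q * C)))) * (qInf q (d * q) * qInf q (e * q) *
        (qInf q (q / d) * qInf q (q / e))) =
      qInf q (d * (q * B)) * qInf q (e * (q * B)) * (qInf q (d * (q * C)) * qInf q (e * (q * C))) *
      ((1 - d * e) * (qInf q q * qInf q q * (qInf q (d * e * q) * qInf q (q / (d * e))))) := by
  rw [tsum_pairTerm_reduce hq0 hq hd0 he0 hd he hB hC h, mul_assoc,
    tsum_pairTerm_zero hq0 hq hd0 he0 hd he]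

/-! ### The terms of the bilateral series -/

theorem qPoch_ne_zero {q x : ℂ} (hx : ∀ n : ℤ, x * q ^ n ≠ 1) (n : ℤ) :
    qPoch q x n ≠ 0 := by
  cases n with
  | ofNat n =>
    refine prod_ne_zero_iff.2 fun k _ => sub_ne_zero.2 ?_
    have := hx k
    rw [zpow_natCast] at this
    exact this.symm
  | negSucc n =>
    refine inv_ne_zero (prod_ne_zero_iff.2 fun k _ => sub_ne_zero.2 ?_)
    have := hx (Int.negSucc k)
    rw [zpow_negSucc, ← div_eq_mul_inv] at this
    exact this.symm

theorem qPoch_mul_eq {q x : ℂ} (hq0 : q ≠ 0) (hx : ∀ n : ℤ, x * q ^ n ≠ 1) (n : ℤ) :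
    qPoch q x n * (1 - x * q ^ n) = qPoch q (x * q) n * (1 - x) := by
  cases n with
  | ofNat n =>
    have h := prod_range_succ (fun k => 1 - x * q ^ k) n
    rw [prod_range_succ'] at h
    simp only [qPoch, Int.ofNat_eq_natCast, zpow_natCast]
    rw [← h, pow_zero, mul_one]
    simp only [mul_assoc, pow_succ']
  | negSucc n =>
    have h0 := qPoch_ne_zero hx (Int.negSucc n)
    have h1 := qPoch_ne_zero (x := x * q) (fun m => by
      have := hx (m + 1)
      rwa [zpow_add_one₀ hq0, mul_comm _ q, ← mul_assoc] at this) (Int.negSucc n)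
    have e := prod_range_succ' (fun k => 1 - x / q ^ k) (n + 1)
    rw [prod_range_succ, pow_zero, div_one] at e
    have e2 : ∏ k ∈ range (n + 1), (1 - x * q / q ^ (k + 1)) =
        ∏ k ∈ range (n + 1), (1 - x / q ^ k) := by
      refine prod_congr rfl fun k _ => ?_
      rw [pow_succ, mul_div_mul_right _ _ hq0]
    simp only [qPoch] at h0 h1 ⊢
    rw [ne_eq, inv_eq_zero] at h0 h1
    rw [inv_mul_eq_iff_eq_mul₀ h0, ← mul_assoc, mul_comm _ (_⁻¹), mul_assoc,
      eq_inv_mul_iff_mul_eq₀ h1, e2, zpow_negSucc, ← div_eq_mul_inv, e]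

theorem qPoch_mul_div_qPoch {q x : ℂ} (hq0 : q ≠ 0) (hx : ∀ n : ℤ, x * q ^ n ≠ 1) (n : ℤ) :
    qPoch q (x * q) n / qPoch q x n = (1 - x * q ^ n) / (1 - x) := by
  have h1 : 1 - x ≠ 0 := sub_ne_zero.2 (by simpa using (hx 0).symm)
  rw [div_eq_div_iff (qPoch_ne_zero hx n) h1, ← qPoch_mul_eq hq0 hx, mul_comm]

theorem qPoch_div_qPoch_mul {q d : ℂ} (hq0 : q ≠ 0) (h : AvoidsPowers q d) (n : ℤ) :
    qPoch q d n / qPoch q (d * q) n = ratioFactor q d n := by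
  by_cases hd : d = 1
  · subst hd
    rw [ratioFactor]
    cases n with
    | ofNat n =>
      cases n with
      | zero => simp [qPoch]
      | succ n =>
        rw [if_neg (by simp; omega), sub_self, zero_div, div_eq_zero_iff]
        exact Or.inl (prod_eq_zero (mem_range.2 n.succ_pos) (by simp))
    | negSucc n =>
      rw [if_neg (by simp), sub_self, zero_div, div_eq_zero_iff]
      -- For d = 1 and n < 0 the lower factorial (q;q)_n has a pole; its default value 0 makes the
      -- quotient 0, which is the correct value.
      refine Or.inr (inv_eq_zero.2 (prod_eq_zero (mem_range.2 n.succ_pos) ?_))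
      simp [hq0]
  · have hx : ∀ n : ℤ, d * q ^ n ≠ 1 := fun n => by
      by_cases hn : n = 0
      · simpa [hn] using hd
      · exact h n hn
    rw [← inv_div, qPoch_mul_div_qPoch hq0 hx, inv_div, ratioFactor]
    split_ifs with hn
    · rw [hn, zpow_zero, mul_one, div_self (sub_ne_zero.2 (Ne.symm hd))]
    · rfl

/-- The terms of the `₈ψ₈` series with parameters `a = d e = y z`, `b = B⁻¹`, `c = C⁻¹`, `d`, `e`,
`y`, `z`, multiplied by `1 - a`. -/
def doublePairTerm (q d e y z B C : ℂ) (n : ℤ) : ℂ :=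
  (d * e * q) ^ n * q ^ n * (wp q (d * e) B n * wp q (d * e) C n) *
    (1 - d * e * (q ^ n) ^ 2) *
    (ratioFactor q d n * ratioFactor q e n * (ratioFactor q y n * ratioFactor q z n))

/-- The pairs (d, e) and (y, z) collapse to `ratioFactor`s because aq/d = eq and aq/y = zq, while
±q√a yield (1 - aq^(2n))/(1 - a). -/
theorem vwpPsiTerm_eq {q b c d e y z : ℂ} (hq0 : q ≠ 0) (hb : b ≠ 0) (hc : c ≠ 0) (hd : d ≠ 0)
    (he : e ≠ 0) (hy : y ≠ 0) (hz : z ≠ 0) (hyz : y * z = d * e) (hbc : b * c = z * q)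
    (ha : ∀ k : ℤ, d * e ≠ q ^ (2 * k)) (hd' : AvoidsPowers q d) (he' : AvoidsPowers q e)
    (hy' : AvoidsPowers q y) (hz' : AvoidsPowers q z) (n : ℤ) :
    vwpPsiTerm q (d * e) [b, c, d, e, y, z] (d * e * q / z) n =
      doublePairTerm q d e y z b⁻¹ c⁻¹ n * (1 - d * e)⁻¹ := by
  have hde := mul_ne_zero hd he
  obtain ⟨s, hs⟩ : ∃ s, s = (d * e) ^ (1 / 2 : ℂ) := ⟨_, rfl⟩
  have hss : s * s = d * e := by
    rw [hs, ← Complex.cpow_add _ _ hde]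
    norm_num
  have hs0 : s ≠ 0 := by
    rintro rfl
    exact hde (by rw [← hss, zero_mul])
  have hsq : ∀ t : ℂ, t * t = d * e → ∀ n : ℤ, t * q ^ n ≠ 1 := by
    intro t ht n h
    refine ha (-n) ?_
    have h2 : (t * q ^ n) * (t * q ^ n) = 1 := by rw [h, one_mul]
    have h3 := zpow_ne_zero n hq0
    rw [← ht, show 2 * -n = -(n + n) by ring, zpow_neg, zpow_add₀ hq0]
    field_simp
    linear_combination h2
  have w1 : d * e * q / (q * s) = s := by rw [← hss]; field_simp
  have w2 : d * e * q / -(q * s) = -s := by rw [← hss]; field_simp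
  have w3 : d * e * q / d = e * q := by field_simp
  have w4 : d * e * q / e = d * q := by field_simp
  have w5 : d * e * q / y = z * q := by rw [← hyz]; field_simp
  have w6 : d * e * q / z = y * q := by rw [← hyz]; field_simp
  -- Here bc = zq enters: b⁻ⁿ and c⁻ⁿ are absorbed by `wp`, leaving one extra q^n, which `wp_shift`
  -- consumes later.
  have w7 : d * e * q / z = d * e * q * q * b⁻¹ * c⁻¹ := by
    field_simp
    linear_combination hbc
  have hw1 := qPoch_mul_div_qPoch hq0 (hsq s hss) n
  have hw2 := qPoch_mul_div_qPoch hq0 (hsq (-s) (by rw [neg_mul_neg, hss])) n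
  have hq1 := qPoch_div_qPoch_mul hq0 hd' n
  have hq2 := qPoch_div_qPoch_mul hq0 he' n
  have hq3 := qPoch_div_qPoch_mul hq0 hy' n
  have hq4 := qPoch_div_qPoch_mul hq0 hz' n
  have hw : (1 - s * q ^ n) / (1 - s) * ((1 - -s * q ^ n) / (1 - -s)) =
      (1 - d * e * (q ^ n) ^ 2) * (1 - d * e)⁻¹ := by
    rw [div_mul_div_comm, ← hss, div_eq_mul_inv]
    ring
  rw [vwpPsiTerm, psiTerm, w7]
  simp only [vwpUpper, List.map_cons, List.map_nil, qPochs, List.prod_cons, List.prod_nil, ← hs,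
    w1, w2, w3, w4, w5, mul_one]
  rw [w6, doublePairTerm, wp_inv_eq hq0 hde hb, wp_inv_eq hq0 hde hc, mul_zpow _ c⁻¹,
    mul_zpow _ b⁻¹, mul_zpow _ q, ← hq1, ← hq2, ← hq3, ← hq4,
    mul_right_comm _ (1 - d * e * (q ^ n) ^ 2), mul_assoc _ _ (1 - d * e)⁻¹, ← hw, ← hw1, ← hw2,
    neg_mul, mul_comm s q]
  simp only [div_eq_mul_inv, mul_inv]
  ring

/-! ### Splitting the ₈ψ₈ series into two ₆ψ₆ series -/

/-- Partial fractions in X = q^n: since de = yz, the quadratics (1-dX)(1-eX) and (1-yX)(1-zX) differ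
only in their linear coefficient, by y + z - d - e. -/
theorem doublePairTerm_eq {q d e y z B C : ℂ} (hq0 : q ≠ 0) (hd0 : d ≠ 0) (he0 : e ≠ 0)
    (hyz : y * z = d * e) (hd : AvoidsPowers q d) (he : AvoidsPowers q e) (hy : AvoidsPowers q y)
    (hz : AvoidsPowers q z) (hB : WpRegular q (d * e) B) (n : ℤ) :
    doublePairTerm q d e y z B C n *
        ((y + z - d - e) * ((1 - q * B) * (1 - d * e * (q * B)))) =
      (1 - d) * (1 - e) * ((1 - y * (q * B)) * (1 - z * (q * B))) * pairTerm q y z (q * B) C n -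
        (1 - y) * (1 - z) * ((1 - d * (q * B)) * (1 - e * (q * B))) *
          pairTerm q d e (q * B) C n := by
  have h1 := wp_shift hq0 (mul_ne_zero hd0 he0) hB n
  have e1 := ratioFactor_mul hd n
  have e2 := ratioFactor_mul he n
  have e3 := ratioFactor_mul hy n
  have e4 := ratioFactor_mul hz n
  have hP : ∀ t : ℂ, (1 - y * t) * (1 - z * t) = 1 - (y + z) * t + d * e * t ^ 2 := fun t => by
    linear_combination t ^ 2 * hyz
  rw [doublePairTerm, pairTerm, pairTerm, pairWeight, pairWeight, hyz, hP (q * B)]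
  have h5 := hP (q ^ n)
  rw [← e1, ← e2, ← e3, ← e4]
  generalize q ^ n = X at *
  generalize ratioFactor q d n = r at *
  generalize ratioFactor q e n = s at *
  generalize ratioFactor q y n = u at *
  generalize ratioFactor q z n = v at *
  generalize (d * e * q) ^ n = A at *
  linear_combination (A * wp q (d * e) C n * (1 - d * e * X ^ 2) * (r * s * (u * v)) *
    (y + z - d - e)) * h1 + (A * wp q (d * e) C n * (1 - d * e * X ^ 2) * (r * s * (u * v)) *
    wp q (d * e) (q * B) n * ((1 - d * (q * B)) * (1 - e * (q * B)))) * h5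

theorem hasSum_doublePairTerm {q d e y z B C : ℂ} (hq0 : q ≠ 0) (hq : ‖q‖ < 1) (hd0 : d ≠ 0)
    (he0 : e ≠ 0) (hyz : y * z = d * e) (hd : AvoidsPowers q d) (he : AvoidsPowers q e)
    (hy : AvoidsPowers q y) (hz : AvoidsPowers q z) (hB : WpRegular q (d * e) B)
    (h : ‖d * e * q * (q * B) * C‖ < 1)
    (hk : (y + z - d - e) * ((1 - q * B) * (1 - d * e * (q * B))) ≠ 0) :
    HasSum (doublePairTerm q d e y z B C)
      (((1 - d) * (1 - e) * ((1 - y * (q * B)) * (1 - z * (q * B))) *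
          ∑' n, pairTerm q y z (q * B) C n -
        (1 - y) * (1 - z) * ((1 - d * (q * B)) * (1 - e * (q * B))) *
          ∑' n, pairTerm q d e (q * B) C n) /
        ((y + z - d - e) * ((1 - q * B) * (1 - d * e * (q * B))))) := by
  have hyz0 : y * z ≠ 0 := by
    rw [hyz]
    exact mul_ne_zero hd0 he0
  have h1 := (summable_pairTerm hq0 hq hd0 he0 h).hasSum
  have h2 := (summable_pairTerm (d := y) (e := z) hq0 hq (left_ne_zero_of_mul hyz0)
    (right_ne_zero_of_mul hyz0) (by rwa [hyz])).hasSum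
  convert ((h2.mul_left ((1 - d) * (1 - e) * ((1 - y * (q * B)) * (1 - z * (q * B))))).sub
    (h1.mul_left ((1 - y) * (1 - z) * ((1 - d * (q * B)) * (1 - e * (q * B)))))).div_const
    ((y + z - d - e) * ((1 - q * B) * (1 - d * e * (q * B)))) using 1
  · rfl
  funext n
  rw [eq_div_iff hk]
  exact doublePairTerm_eq hq0 hd0 he0 hyz hd he hy hz hB n

/-- Here x' is the lower parameter under the partner of x: it excludes one sign of the exponent, and
the condition on x itself the other. -/
theorem avoidsPowers_of {q x x' : ℂ} (hq0 : q ≠ 0) (h1 : ∀ k : ℕ, x ≠ q ^ (k + 1))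
    (h2 : ∀ k : ℕ, x' * q ^ k ≠ 1) (hx : x' = x * q) : AvoidsPowers q x := by
  intro n hn h
  obtain ⟨m, rfl | rfl⟩ := n.eq_nat_or_neg
  · obtain ⟨m, rfl⟩ := Nat.exists_eq_succ_of_ne_zero (n := m) (by simpa using hn)
    refine h2 m ?_
    rw [hx, mul_assoc, ← pow_succ']
    exact_mod_cast h
  · obtain ⟨m, rfl⟩ := Nat.exists_eq_succ_of_ne_zero (n := m) (by simpa using hn)
    refine h1 m ?_
    rw [zpow_neg, zpow_natCast, ← div_eq_mul_inv, div_eq_one_iff_eq (pow_ne_zero _ hq0)] at h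
    exact h

theorem wpRegular_inv {q a b : ℂ} (hb : b ≠ 0) (h1 : ∀ k : ℕ, b ≠ q ^ (k + 1))
    (h2 : ∀ k : ℕ, a * q / b * q ^ k ≠ 1) : WpRegular q a b⁻¹ := fun k => by
  refine ⟨fun h => h1 k ?_, fun h => h2 k ?_⟩
  · field_simp at h
    exact h.symm
  · rw [← h]
    ring

theorem WpRegular.qInf_ne_zero {q a B : ℂ} (hq : ‖q‖ < 1) (h : WpRegular q a B) :
    qInf q (q * B) ≠ 0 ∧ qInf q (a * (q * B)) ≠ 0 := by
  refine ⟨QSeries.qInf_ne_zero hq fun k => ?_, QSeries.qInf_ne_zero hq fun k => ?_⟩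
  · convert (h k).1 using 1
    ring
  · convert (h k).2 using 1
    ring

end QSeries

end

/-! ### Assembly of the summation formula -/

open QSeries in
theorem mainTheorem9 (q a b c d e z : ℂ)
    (hq0 : q ≠ 0) (hq1 : ‖q‖ < 1)
    (hb : b ≠ 0) (hc : c ≠ 0) (hd : d ≠ 0) (he : e ≠ 0)
    (ha : a = d * e) (hbc : b * c = z * q)
    -- the argument of the series
    (hconv : ‖a * q / z‖ < 1)
    -- no denominator in the terms of the series vanishes
    (ha_pole : ∀ k : ℤ, a ≠ q ^ (2 * k))
    (h_upper : ∀ x ∈ [b, c, d, e, a / z, z], ∀ k : ℕ, x ≠ q ^ (k + 1))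
    (h_lower : ∀ x ∈ [b, c, d, e, a / z, z], ∀ k : ℕ, a * q / x * q ^ k ≠ 1)
    -- the two remaining factors in the denominator of the product do not vanish
    (hdz : ∀ k : ℕ, d / z * q ^ k ≠ 1)
    (hez : ∀ k : ℕ, e / z * q ^ k ≠ 1) :
    Summable (QSeries.vwpPsiTerm q a [b, c, d, e, a / z, z] (a * q / z)) ∧
    QSeries.vwpPsi q a [b, c, d, e, a / z, z] (a * q / z) =
      QSeries.qInfs q [q, q, a * q, q / a, a * q / (d * z), a * q / (e * z)] *
        ((QSeries.thetas q [d, e] *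
              QSeries.qInfs q [b, c, a * q / (b * z), a * q / (c * z)] -
            QSeries.thetas q [z, a / z] *
              QSeries.qInfs q [a * q / (b * d), a * q / (b * e),
                a * q / (c * d), a * q / (c * e)]) /
          (z * QSeries.qInfs q [q / d, q / e, z * q, a * q / z])) /
        (QSeries.qInfs q [q / z, z * q / a] *
          QSeries.Omega q [1 / z] [1 / b, 1 / c, 1 / d, 1 / e] *
          QSeries.Omega q [a * q] [b, c, d, e]) := by
  subst ha
  have hz : z ≠ 0 := left_ne_zero_of_mul (hbc ▸ mul_ne_zero hb hc)
  obtain ⟨y, hy⟩ : ∃ y, y = d * e / z := ⟨_, rfl⟩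
  have hde := mul_ne_zero hd he
  have hyz : y * z = d * e := by rw [hy, div_mul_cancel₀ _ hz]
  have hy0 : y ≠ 0 := left_ne_zero_of_mul (hyz ▸ hde)
  rw [← hy] at h_upper h_lower
  have hd' : AvoidsPowers q d := avoidsPowers_of hq0 (h_upper d (by simp))
    (h_lower e (by simp)) (by field_simp)
  have he' : AvoidsPowers q e := avoidsPowers_of hq0 (h_upper e (by simp))
    (h_lower d (by simp)) (by field_simp)
  have hy' : AvoidsPowers q y := avoidsPowers_of hq0 (h_upper y (by simp))
    (h_lower z (by simp)) (by rw [← hyz]; field_simp)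
  have hz' : AvoidsPowers q z := avoidsPowers_of hq0 (h_upper z (by simp))
    (h_lower y (by simp)) (by rw [← hyz]; field_simp)
  have hB : WpRegular q (d * e) b⁻¹ :=
    wpRegular_inv hb (h_upper b (by simp)) (h_lower b (by simp))
  have hC : WpRegular q (d * e) c⁻¹ :=
    wpRegular_inv hc (h_upper c (by simp)) (h_lower c (by simp))
  have hnorm : ‖d * e * q * (q * b⁻¹) * c⁻¹‖ < 1 := by
    convert hconv using 2
    field_simp
    linear_combination -hbc
  have ha1 : 1 - d * e ≠ 0 := sub_ne_zero.2 (by simpa using (ha_pole 0).symm)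
  have hE : 1 - q * b⁻¹ ≠ 0 := sub_ne_zero.2 (by
    have := (hB 0).1
    rw [zero_add, pow_one, mul_comm] at this
    exact this.symm)
  have haE : 1 - d * e * (q * b⁻¹) ≠ 0 := sub_ne_zero.2 (by
    have := (hB 0).2
    rw [zero_add, pow_one, mul_assoc, mul_comm _ q] at this
    exact this.symm)
  have hdz0 : 1 - d / z ≠ 0 := sub_ne_zero.2 (by simpa using (hdz 0).symm)
  have hez0 : 1 - e / z ≠ 0 := sub_ne_zero.2 (by simpa using (hez 0).symm)
  -- The partial fraction denominator; it supplies the factor z of Δ and the first factors of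
  -- (d/z;q)_∞ and (e/z;q)_∞ in Ω.
  have hκ : y + z - d - e = z * ((1 - d / z) * (1 - e / z)) := by
    rw [hy]
    field_simp
    ring
  have hκ0 : y + z - d - e ≠ 0 := by
    rw [hκ]
    exact mul_ne_zero hz (mul_ne_zero hdz0 hez0)
  have hsum := (hasSum_doublePairTerm hq0 hq1 hd he hyz hd' he' hy' hz' hB hnorm
    (mul_ne_zero hκ0 (mul_ne_zero hE haE))).mul_right (1 - d * e)⁻¹
  rw [← hy]
  have hterm : vwpPsiTerm q (d * e) [b, c, d, e, y, z] (d * e * q / z) =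
      fun n => doublePairTerm q d e y z b⁻¹ c⁻¹ n * (1 - d * e)⁻¹ :=
    funext fun n => vwpPsiTerm_eq hq0 hb hc hd he hy0 hz hyz hbc ha_pole hd' he' hy' hz' n
  rw [vwpPsi, hterm]
  refine ⟨hsum.summable, hsum.tsum_eq.trans ?_⟩
  have s1 := tsum_pairTerm_eq hq0 hq1 hd he hd' he' hB.shift hC hnorm
  have s2 := tsum_pairTerm_eq (d := y) (e := z) (B := q * b⁻¹) (C := c⁻¹) hq0 hq1 hy0 hz hy' hz'
    (by rw [hyz]; exact hB.shift) (by rw [hyz]; exact hC) (by rwa [hyz])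
  rw [hyz] at s2
  -- The ₆ψ₆ sums are taken at q/b in place of 1/b; the linear factors from the splitting restore
  -- the products of the statement.
  have f : ∀ x t : ℂ, (1 - x * t) * qInf q (x * (q * t)) = qInf q (x * t) := fun x t => by
    rw [qInf_eq_mul hq1 (x * t)]
    ring_nf
  have f1 := f 1 (q * b⁻¹)
  rw [one_mul, one_mul] at f1
  have f2 := f (d * e) (q * b⁻¹)
  have f3 := f d (q * b⁻¹)
  have f4 := f e (q * b⁻¹)
  have f5 := f y (q * b⁻¹)
  have f6 := f z (q * b⁻¹)
  have n1 := hB.qInf_ne_zero hq1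
  have n2 := hC.qInf_ne_zero hq1
  have m1 := hd'.qInf_ne_zero hq1
  have m2 := he'.qInf_ne_zero hq1
  have m3 := hy'.qInf_ne_zero hq1
  have m4 := hz'.qInf_ne_zero hq1
  have m5 := (hd'.inv hq0 hd).qInf_ne_zero hq1
  have m6 := (he'.inv hq0 he).qInf_ne_zero hq1
  have m7 := (hy'.inv hq0 hy0).qInf_ne_zero hq1
  have m8 := (hz'.inv hq0 hz).qInf_ne_zero hq1
  rw [inv_mul_eq_div] at m5 m6 m7 m8
  have p1 : qInf q (d / z) ≠ 0 := qInf_ne_zero hq1 hdz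
  have p2 : qInf q (e / z) ≠ 0 := qInf_ne_zero hq1 hez
  rw [qInf_eq_mul hq1, mul_ne_zero_iff] at p1 p2
  have hqz : q = b * c / z := by rw [hbc]; field_simp
  simp only [qInfs, thetas, Omega, List.map_cons, List.map_nil, List.prod_cons, List.prod_nil,
    mul_one]
  rw [theta_eq hq0 hq1 hd, theta_eq hq0 hq1 he, theta_eq hq0 hq1 hz, theta_eq hq0 hq1 hy0,
    qInf_eq_mul hq1 d, qInf_eq_mul hq1 e, qInf_eq_mul hq1 z, qInf_eq_mul hq1 y]
  rw [show d * e * q / (d * z) = e / z * q by field_simp,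
    show d * e * q / (e * z) = d / z * q by field_simp,
    show d * e * q / (b * z) = y * (q * b⁻¹) by rw [hy]; field_simp,
    show d * e * q / (c * z) = y * (q * c⁻¹) by rw [hy]; field_simp,
    show d * e * q / (b * d) = e * (q * b⁻¹) by field_simp,
    show d * e * q / (b * e) = d * (q * b⁻¹) by field_simp,
    show d * e * q / (c * d) = e * (q * c⁻¹) by field_simp,
    show d * e * q / (c * e) = d * (q * c⁻¹) by field_simp,
    show d * e * q / z = y * q by rw [hy]; field_simp,
    show z * q / (d * e) = q / y by rw [hy]; field_simp,
    show 1 / z / (1 / b) = q * c⁻¹ by field_simp; exact hbc,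
    show 1 / z / (1 / c) = q * b⁻¹ by field_simp; linear_combination hbc,
    show 1 / z / (1 / d) = d / z by field_simp,
    show 1 / z / (1 / e) = e / z by field_simp,
    show d * e * q / b = d * e * (q * b⁻¹) by field_simp,
    show d * e * q / c = d * e * (q * c⁻¹) by field_simp,
    show d * e * q / d = e * q by field_simp,
    show d * e * q / e = d * q by field_simp,
    show qInf q b = qInf q (z * (q * c⁻¹)) by congr 1; field_simp; exact hbc,
    show qInf q c = qInf q (z * (q * b⁻¹)) by congr 1; field_simp; linear_combination hbc,
    qInf_eq_mul hq1 (d / z), qInf_eq_mul hq1 (e / z), hκ]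
  rw [← f1, ← f2, mul_ne_zero_iff, mul_ne_zero_iff] at n1
  rw [← f1, ← f2, ← f3, ← f4, ← f5, ← f6]
  have W1 := eq_div_of_mul_eq (mul_ne_zero (mul_ne_zero m1 m2) (mul_ne_zero m5 m6)) s1
  have W2 := eq_div_of_mul_eq (mul_ne_zero (mul_ne_zero m3 m4) (mul_ne_zero m7 m8)) s2
  have n3 := mul_ne_zero (mul_ne_zero n1.1.2 n1.2.2) (mul_ne_zero n2.1 n2.2)
  rw [eq_div_of_mul_eq n3 W1, eq_div_of_mul_eq n3 W2]
  obtain ⟨⟨n11, n12⟩, n13, n14⟩ := n1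
  obtain ⟨n21, n22⟩ := n2
  obtain ⟨p11, p12⟩ := p1
  obtain ⟨p21, p22⟩ := p2
  clear s1 s2 W1 W2 n3 f f1 f2 f3 f4 f5 f6 hsum hterm hκ hκ0 h_upper h_lower hdz hez hd' he' hy'
    hz' hB hC hnorm hconv ha_pole
  -- With each infinite product and linear factor a free variable, the claim is a rational identity.
  generalize 1 - d / z = k1 at *
  generalize 1 - e / z = k2 at *
  generalize qInf q (d / z * q) = Q1 at *
  generalize qInf q (e / z * q) = Q2 at *
  generalize qInf q (q * (q * b⁻¹)) = g1 at *
  generalize qInf q (d * e * (q * (q * b⁻¹))) = g2 at *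
  generalize qInf q (d * (q * (q * b⁻¹))) = g3 at *
  generalize qInf q (e * (q * (q * b⁻¹))) = g4 at *
  generalize qInf q (y * (q * (q * b⁻¹))) = g5 at *
  generalize qInf q (z * (q * (q * b⁻¹))) = g6 at *
  generalize qInf q (q * c⁻¹) = h1 at *
  generalize qInf q (d * e * (q * c⁻¹)) = h2 at *
  generalize qInf q (d * (q * c⁻¹)) = h3 at *
  generalize qInf q (e * (q * c⁻¹)) = h4 at *
  generalize qInf q (y * (q * c⁻¹)) = h5 at *
  generalize qInf q (z * (q * c⁻¹)) = h6 at *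
  generalize qInf q (d * q) = i1 at *
  generalize qInf q (e * q) = i2 at *
  generalize qInf q (y * q) = i3 at *
  generalize qInf q (z * q) = i4 at *
  generalize qInf q (q / d) = j1 at *
  generalize qInf q (q / e) = j2 at *
  generalize qInf q (q / y) = j3 at *
  generalize qInf q (q / z) = j4 at *
  generalize 1 - q * b⁻¹ = α1 at *
  generalize 1 - d * e * (q * b⁻¹) = α2 at *
  generalize 1 - d * (q * b⁻¹) = α3 at *
  generalize 1 - e * (q * b⁻¹) = α4 at *
  generalize 1 - y * (q * b⁻¹) = α5 at *
  generalize 1 - z * (q * b⁻¹) = α6 at *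
  generalize 1 - d * e = δ at *
  field_simp
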